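/- Let $d_1,d_2,d_C\ge 1$ be integers with $d_C\le d_{12}:=d_1d_2$, let $\mathcal H_{B_1}=\mathbb C^{d_1}$, $\mathcal H_{B_2}=\mathbb C^{d_2}$ and $\mathcal H_{B_1B_2}=\mathcal H_{B_1}\otimes\mathcal H_{B_2}$, and let $\mathcal H_C$ be a random $d_C$-dimensional subspace of $\mathcal H_{B_1B_2}$, distributed according to the unitarily invariant probability measure on the Grassmannian of all $d_C$-dimensional subspaces of $\mathcal H_{B_1B_2}$. For a unit vector $|\psi\rangle\in\mathcal H_{B_1B_2}$ let $\psi_{B_1}=\mathrm{Tr}_{B_2}|\psi\rangle\langle\psi|$ be its reduced state on $B_1$, and let $\|\cdot\|_1$ be the trace norm (the sum of the singular values). Put $$\widetilde\Lambda^{\mathrm M}_{B_1}(\mathcal H_C):=\max_{|\psi\rangle\in\mathcal H_C,\ \langle\psi|\psi\rangle=1}\left\|\psi_{B_1}-\frac{\mathbb 1}{d_1}\right\|_1 .$$ Then for every real $\alpha>0$, $$\Pr\left\{\widetilde\Lambda^{\mathrm M}_{B_1}(\mathcal H_C)>r+\alpha\right\}\le 2\left(\frac{10}{\alpha}\right)^{2d_C}\exp\left(-\frac{d_{12}\,\alpha^2}{72\pi^3\ln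 2}\right),\qquad r=\sqrt{\frac{d_1^2-1}{d_{12}+1}} .$$ -/

import Mathlib

open MeasureTheory Module

noncomputable section

namespace RandomSubspace

/-- The `k`-dimensional subspaces of a Hilbert space `E`. -/
def Gr (E : Type*) [NormedAddCommGroup E] [InnerProductSpace ℂ E] (k : ℕ) : Type _ :=
  {W : Submodule ℂ E // finrank ℂ W = k}

namespace Gr

variable {E : Type*} [NormedAddCommGroup E] [InnerProductSpace ℂ E] [FiniteDimensional ℂ E]
  {k : ℕ}

/-- The orthogonal projection onto a subspace. -/
def proj (W : Gr E k) : E →L[ℂ] E := W.1.starProjection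

/-- The usual topology of the Grassmannian: subspaces are close when their orthogonal projections
are close in operator norm. -/
instance : TopologicalSpace (Gr E k) := TopologicalSpace.induced proj inferInstance

/-- The Borel σ-algebra of the Grassmannian. -/
instance : MeasurableSpace (Gr E k) := borel _

instance : BorelSpace (Gr E k) := ⟨rfl⟩

/-- The image of a subspace under a unitary operator of `E`. -/
def unitaryMap (U : E ≃ₗᵢ[ℂ] E) (W : Gr E k) : Gr E k :=
  ⟨W.1.map (U.toLinearEquiv : E →ₗ[ℂ] E), by
    rw [LinearEquiv.finrank_map_eq]; exact W.2⟩

/-- `μ` is the law of a (uniformly) random `k`-dimensional subspace of `E`: a probability measure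
on the Grassmannian that is invariant under all unitary operators. -/
structure IsUniform (μ : Measure (Gr E k)) : Prop where
  isProbabilityMeasure : IsProbabilityMeasure μ
  measurePreserving : ∀ U : E ≃ₗᵢ[ℂ] E, MeasurePreserving (unitaryMap U) μ μ

end Gr

/-- The bipartite space `ℂ^d₁ ⊗ ℂ^d₂`, in the orthonormal product basis `e_i ⊗ e_j`. -/
abbrev Bipartite (d₁ d₂ : ℕ) : Type := EuclideanSpace ℂ (Fin d₁ × Fin d₂)

/-- The operator `|ψ⟩⟨ψ|`. -/
def density {ι : Type*} [Fintype ι] (ψ : EuclideanSpace ℂ ι) : Matrix ι ι ℂ :=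
  Matrix.of fun i j => ψ i * star (ψ j)

/-- The partial trace over the second tensor factor. -/
def partialTrace₂ {d₁ d₂ : ℕ} (ρ : Matrix (Fin d₁ × Fin d₂) (Fin d₁ × Fin d₂) ℂ) :
    Matrix (Fin d₁) (Fin d₁) ℂ :=
  Matrix.of fun i j => ∑ k, ρ (i, k) (j, k)

/-- The trace norm: the sum of all singular values, with multiplicity. -/
def traceNorm {d : ℕ} (A : Matrix (Fin d) (Fin d) ℂ) : ℝ :=
  ∑ i ∈ Finset.range d, (Matrix.toEuclideanLin A).singularValues i

/-- The trace distance, without a factor `1 / 2`. -/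
def traceDist {d : ℕ} (ρ σ : Matrix (Fin d) (Fin d) ℂ) : ℝ := traceNorm (ρ - σ)

/-- The maximally mixed state. -/
def maxMixed (d : ℕ) : Matrix (Fin d) (Fin d) ℂ := (d : ℂ)⁻¹ • 1

/-- The pure states (unit vectors) contained in a subspace. -/
def pureStates {E : Type*} [NormedAddCommGroup E] [InnerProductSpace ℂ E] (W : Submodule ℂ E) :
    Set E := {ψ | ψ ∈ W ∧ ‖ψ‖ = 1}

/-- The maximum, over the vectors `ψ` in a set of pure states, of the trace distance between the
reduced state of `ψ` on the first subsystem and the maximally mixed state. -/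
def maxInaccuracy₁ {d₁ d₂ : ℕ} (C : Set (Bipartite d₁ d₂)) : ℝ :=
  sSup ((fun ψ => traceDist (partialTrace₂ (density ψ)) (maxMixed d₁)) '' C)

end RandomSubspace

end

noncomputable section

open ProbabilityTheory

/-! For a fixed unit vector the inaccuracy concentrates near its mean, and a union bound over a net
of the subspace controls the maximum. By unitary invariance, `Gr.IsUniform.measure_exceed_le`
replaces the random subspace by a Haar-random rotation of a fixed one.

Concentration (`haarUnitary_real_lt_apply_le`) comes from Gaussian space. The rotation argument of
Maurey and Pisier bounds the exponential moment of an `L`-Lipschitz function by `exp (s²π²L²/8)`. A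
function `f` on the sphere with Lipschitz constant `K` and bound `B` extends to `‖x‖ f(x/‖x‖)`, with
Lipschitz constant `B + 2K`. A Gaussian vector has a uniform direction independent of its norm, and
the norm has mean at least `√(4n/π)`, so the bound passes to the sphere. For the inaccuracy, duality
of the trace norm with contractions gives `K = B = 2`.

The mean is at most `r`: Cauchy–Schwarz bounds the squared inaccuracy by `d₁` times the purity minus
one, and fourth moments on the sphere give mean purity `(d₁ + d₂)/(d₁d₂ + 1)`.

A net of mesh `α/4` costs `α/2` by the Lipschitz bound and leaves `α/2` for the deviation. It has at
most `(1 + 8/α)^(2 dC)` points. For `α > 2` the event is empty. -/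

theorem ofReal_exp_integral_le_lintegral {Ω : Type*} [MeasurableSpace Ω] (μ : Measure Ω)
    [IsProbabilityMeasure μ] {h : Ω → ℝ} (hh : Integrable h μ) :
    ENNReal.ofReal (Real.exp (∫ ω, h ω ∂μ)) ≤ ∫⁻ ω, ENNReal.ofReal (Real.exp (h ω)) ∂μ := by
  set a := ∫ ω, h ω ∂μ with ha
  -- Jensen through the tangent line of `exp` at the mean `a`; the right side may be infinite, so
  -- `exp ∘ h` need not be integrable.
  have hi : Integrable (fun ω => Real.exp a * (1 + (h ω - a))) μ :=
    ((integrable_const _).add (hh.sub (integrable_const _))).const_mul _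
  have hval : ∫ ω, Real.exp a * (1 + (h ω - a)) ∂μ = Real.exp a := by
    have h1 : ∫ ω, (1 + (h ω - a)) ∂μ = 1 := by
      rw [integral_add (g := fun ω => h ω - a) (integrable_const _) (hh.sub (integrable_const _)),
        integral_sub hh (integrable_const _)]
      simp [← ha]
    rw [integral_const_mul, h1, mul_one]
  calc ENNReal.ofReal (Real.exp a)
      = ENNReal.ofReal (∫ ω, Real.exp a * (1 + (h ω - a)) ∂μ) := by rw [hval]
    _ ≤ ∫⁻ ω, ENNReal.ofReal (Real.exp a * (1 + (h ω - a))) ∂μ := by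
        rw [integral_eq_lintegral_pos_part_sub_lintegral_neg_part hi]
        exact (ENNReal.ofReal_le_ofReal (sub_le_self _ ENNReal.toReal_nonneg)).trans
          ENNReal.ofReal_toReal_le
    _ ≤ _ := by
        refine lintegral_mono fun ω => ENNReal.ofReal_le_ofReal ?_
        have := Real.add_one_le_exp (h ω - a)
        calc Real.exp a * (1 + (h ω - a)) ≤ Real.exp a * Real.exp (h ω - a) := by gcongr; linarith
          _ = Real.exp (h ω) := by rw [← Real.exp_add]; congr 1; ring

/-! ### Gaussian exponential moments by rotation -/

section Gaussian

variable {E : Type*} [NormedAddCommGroup E] [InnerProductSpace ℝ E]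

theorem hasDerivAt_comp_rotation {F : E → ℝ} (hF : Differentiable ℝ F) (x y : E) (θ : ℝ) :
    HasDerivAt (fun θ => F (Real.cos θ • x + Real.sin θ • y))
      (fderiv ℝ F (Real.cos θ • x + Real.sin θ • y) (-Real.sin θ • x + Real.cos θ • y)) θ := by
  have h1 : HasDerivAt (fun θ => Real.cos θ • x + Real.sin θ • y)
      (-Real.sin θ • x + Real.cos θ • y) θ :=
    ((Real.hasDerivAt_cos θ).smul_const x).add ((Real.hasDerivAt_sin θ).smul_const y)
  exact (hF _).hasFDerivAt.comp_hasDerivAt θ h1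

/-- The quarter circle joins `x` to `y`. Its position and velocity together are a rotation of the
pair `(x, y)`, hence again two independent Gaussians when `x` and `y` are. -/
theorem intervalIntegral_fderiv_rotation {F : E → ℝ} (hF : ContDiff ℝ 1 F) (x y : E) :
    ∫ θ in (0:ℝ)..(Real.pi / 2), fderiv ℝ F (Real.cos θ • x + Real.sin θ • y)
      (-Real.sin θ • x + Real.cos θ • y) = F y - F x := by
  have hF' : Continuous (fderiv ℝ F) := hF.continuous_fderiv (by norm_num)
  have hc : Continuous fun θ => fderiv ℝ F (Real.cos θ • x + Real.sin θ • y)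
      (-Real.sin θ • x + Real.cos θ • y) :=
    (hF'.comp (by fun_prop)).clm_apply (by fun_prop)
  rw [intervalIntegral.integral_eq_sub_of_hasDerivAt
    (fun θ _ => hasDerivAt_comp_rotation (hF.differentiable (by norm_num)) x y θ)
    (hc.intervalIntegrable _ _)]
  simp only [Real.cos_pi_div_two, Real.sin_pi_div_two, Real.cos_zero, Real.sin_zero, one_smul,
    zero_smul, zero_add, add_zero]

variable [FiniteDimensional ℝ E] [MeasurableSpace E] [BorelSpace E]

theorem lintegral_exp_dual_stdGaussian (ℓ : StrongDual ℝ E) :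
    ∫⁻ x, ENNReal.ofReal (Real.exp (ℓ x)) ∂(stdGaussian E)
      = ENNReal.ofReal (Real.exp (‖ℓ‖ ^ 2 / 2)) := by
  have hmap := IsGaussian.map_eq_gaussianReal (μ := stdGaussian E) ℓ
  rw [integral_strongDual_stdGaussian, variance_dual_stdGaussian] at hmap
  have h1 : ∫⁻ x, ENNReal.ofReal (Real.exp (ℓ x)) ∂(stdGaussian E)
      = ∫⁻ y, ENNReal.ofReal (Real.exp y) ∂(gaussianReal 0 (‖ℓ‖ ^ 2).toNNReal) := by
    rw [← hmap, lintegral_map (by fun_prop) (by fun_prop)]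
  rw [h1, ← ofReal_integral_eq_lintegral_ofReal]
  · have := congrFun (mgf_id_gaussianReal (μ := 0) (v := (‖ℓ‖ ^ 2).toNNReal)) 1
    simp only [mgf, id, one_mul] at this
    rw [this]
    simp [Real.coe_toNNReal _ (sq_nonneg ‖ℓ‖)]
  · simpa using integrable_exp_mul_gaussianReal (μ := 0) (v := (‖ℓ‖ ^ 2).toNNReal) 1
  · exact Filter.Eventually.of_forall fun _ => (Real.exp_pos _).le

/-- `F y - F x` is `π/2` times an average over the quarter circle. Jensen moves the average outside
`exp`, and rotation invariance makes every angle contribute equally. Given the position, the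
exponent is linear in an independent Gaussian, which gives `(sπ/2)²L²/2`. -/
theorem lintegral_exp_sub_le_of_contDiff {F : E → ℝ} (hF : ContDiff ℝ 1 F) {L : ℝ}
    (hL : ∀ x, ‖fderiv ℝ F x‖ ≤ L) (s : ℝ) :
    ∫⁻ p, ENNReal.ofReal (Real.exp (s * (F p.2 - F p.1))) ∂((stdGaussian E).prod (stdGaussian E))
      ≤ ENNReal.ofReal (Real.exp (s ^ 2 * Real.pi ^ 2 * L ^ 2 / 8)) := by
  set γ := stdGaussian E with hγ
  have hF' : Continuous (fderiv ℝ F) := hF.continuous_fderiv (by norm_num)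
  let R : ℝ → E × E → E × E := fun θ p =>
    (Real.cos θ • p.1 + Real.sin θ • p.2, -Real.sin θ • p.1 + Real.cos θ • p.2)
  have hRc : Continuous (fun q : ℝ × (E × E) => R q.1 q.2) := by
    dsimp only [R]; fun_prop
  let h : ℝ → E × E → ℝ := fun θ p => fderiv ℝ F (R θ p).1 (R θ p).2
  have hhc : Continuous (fun q : ℝ × (E × E) => h q.1 q.2) :=
    (hF'.comp (continuous_fst.comp hRc)).clm_apply (continuous_snd.comp hRc)
  have hhθ : ∀ p, Continuous (fun θ => h θ p) := fun p =>
    by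
    have := hhc.comp (continuous_id.prodMk (continuous_const (y := p)))
    exact this
  have hftc : ∀ p : E × E, ∫ θ in (0:ℝ)..(Real.pi / 2), h θ p = F p.2 - F p.1 := by
    intro p
    exact intervalIntegral_fderiv_rotation hF p.1 p.2
  -- Uniform probability on the angles, as Jensen requires; the normalization produces the factor
  -- `π/2` in the exponent.
  let κ : Measure ℝ := (ENNReal.ofReal (Real.pi / 2))⁻¹ • volume.restrict (Set.Ioc 0 (Real.pi / 2))
  have hpi : (0:ℝ) < Real.pi / 2 := by positivity
  have hκ : IsProbabilityMeasure κ := ⟨by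
    simp only [κ, Measure.smul_apply, Measure.restrict_apply_univ, Real.volume_Ioc, sub_zero,
      smul_eq_mul]
    exact ENNReal.inv_mul_cancel (by simpa using hpi) ENNReal.ofReal_ne_top⟩
  have hjensen : ∀ p : E × E, ENNReal.ofReal (Real.exp (s * (F p.2 - F p.1)))
      ≤ ∫⁻ θ, ENNReal.ofReal (Real.exp (s * (Real.pi / 2) * h θ p)) ∂κ := by
    intro p
    have hint : Integrable (fun θ => s * (Real.pi / 2) * h θ p) κ := by
      refine Integrable.smul_measure ?_ (by simpa using hpi)
      exact (((hhθ p).const_mul _ |>.integrableOn_Icc).mono_set Set.Ioc_subset_Icc_self :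
        IntegrableOn _ (Set.Ioc 0 (Real.pi / 2)) volume)
    have := ofReal_exp_integral_le_lintegral κ hint
    convert this using 3
    rw [integral_const_mul, integral_smul_measure, ← intervalIntegral.integral_of_le hpi.le, hftc]
    simp only [ENNReal.toReal_inv, ENNReal.toReal_ofReal hpi.le, smul_eq_mul]
    field_simp
  have hmeas : Measurable (fun q : ℝ × (E × E) =>
      ENNReal.ofReal (Real.exp (s * (Real.pi / 2) * h q.1 q.2))) := by
    exact (Real.continuous_exp.comp (continuous_const.mul hhc)).measurable.ennreal_ofReal
  have hmeas' : Measurable (fun p : E × E =>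
      ENNReal.ofReal (Real.exp (s * (Real.pi / 2) * fderiv ℝ F p.1 p.2))) := by
    refine (Real.continuous_exp.comp (continuous_const.mul ?_)).measurable.ennreal_ofReal
    exact (hF'.comp continuous_fst).clm_apply continuous_snd
  have hrot : ∀ θ, ∫⁻ p, ENNReal.ofReal (Real.exp (s * (Real.pi / 2) * h θ p)) ∂(γ.prod γ)
      = ∫⁻ p, ENNReal.ofReal (Real.exp (s * (Real.pi / 2) * fderiv ℝ F p.1 p.2)) ∂(γ.prod γ) := by
    intro θ
    have := IsGaussian.map_rotation_eq_self_of_forall_strongDual_eq_zero (μ := γ)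
      (fun L => integral_strongDual_stdGaussian L) θ
    conv_rhs => rw [← this]
    rw [lintegral_map hmeas' (by fun_prop)]
    simp only [h, R, ContinuousLinearMap.rotation_apply, neg_smul]
  calc _ ≤ ∫⁻ p, ∫⁻ θ, ENNReal.ofReal (Real.exp (s * (Real.pi / 2) * h θ p)) ∂κ ∂(γ.prod γ) :=
        lintegral_mono hjensen
    _ = ∫⁻ θ, ∫⁻ p, ENNReal.ofReal (Real.exp (s * (Real.pi / 2) * h θ p)) ∂(γ.prod γ) ∂κ :=
        lintegral_lintegral_swap (hmeas.comp measurable_swap).aemeasurable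
    _ = ∫⁻ p, ENNReal.ofReal (Real.exp (s * (Real.pi / 2) * fderiv ℝ F p.1 p.2)) ∂(γ.prod γ) := by
        simp [hrot]
    _ = ∫⁻ x, ∫⁻ y, ENNReal.ofReal (Real.exp (s * (Real.pi / 2) * fderiv ℝ F x y)) ∂γ ∂γ :=
        lintegral_prod _ hmeas'.aemeasurable
    _ ≤ ∫⁻ _, ENNReal.ofReal (Real.exp (s ^ 2 * Real.pi ^ 2 * L ^ 2 / 8)) ∂γ := by
        refine lintegral_mono fun x => ?_
        have := lintegral_exp_dual_stdGaussian ((s * (Real.pi / 2)) • fderiv ℝ F x)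
        simp only [smul_apply, smul_eq_mul] at this
        simp only [hγ]
        rw [this]
        refine ENNReal.ofReal_le_ofReal (Real.exp_le_exp.2 ?_)
        rw [norm_smul, mul_pow, Real.norm_eq_abs, sq_abs]
        have h2 : ‖fderiv ℝ F x‖ ^ 2 ≤ L ^ 2 := by gcongr; exact hL x
        have h3 : 0 ≤ (s * (Real.pi / 2)) ^ 2 := sq_nonneg _
        nlinarith [mul_le_mul_of_nonneg_left h2 h3]
    _ = _ := by simp

/-- Convolution with a normalized bump of radius `ε` averages translates: this keeps the Lipschitz
constant and moves values by at most `L ε`. -/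
theorem exists_contDiff_dist_le_of_lipschitzWith {F : E → ℝ} {L : NNReal} (hF : LipschitzWith L F)
    {ε : ℝ} (hε : 0 < ε) :
    ∃ G : E → ℝ, ContDiff ℝ 1 G ∧ (∀ x, ‖fderiv ℝ G x‖ ≤ L) ∧ ∀ x, |G x - F x| ≤ L * ε := by
  let φ : ContDiffBump (0 : E) := ⟨ε / 2, ε, by positivity, by linarith⟩
  let G : E → ℝ := convolution (φ.normed volume) F (ContinuousLinearMap.lsmul ℝ ℝ) volume
  have hGdef : ∀ x, G x = ∫ t, φ.normed volume t * F (x - t) := fun x => by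
    simp [G, convolution_def]
  have hint : ∀ x, Integrable (fun t => φ.normed volume t * F (x - t)) := fun x => by
    refine Continuous.integrable_of_hasCompactSupport ?_ ?_
    · exact φ.continuous_normed.mul (hF.continuous.comp (by fun_prop))
    · exact φ.hasCompactSupport_normed.mul_right
  have hLip : LipschitzWith L G := by
    refine LipschitzWith.of_dist_le_mul fun x y => ?_
    rw [Real.dist_eq, hGdef, hGdef, ← integral_sub (hint x) (hint y)]
    calc |∫ t, φ.normed volume t * F (x - t) - φ.normed volume t * F (y - t)|
        ≤ ∫ t, |φ.normed volume t * F (x - t) - φ.normed volume t * F (y - t)| :=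
          abs_integral_le_integral_abs
      _ ≤ ∫ t, φ.normed volume t * (L * dist x y) := by
          refine integral_mono ((hint x).sub (hint y)).abs (φ.integrable_normed.mul_const _) ?_
          intro t
          dsimp only
          rw [← mul_sub, abs_mul, abs_of_nonneg (φ.nonneg_normed t)]
          refine mul_le_mul_of_nonneg_left ?_ (φ.nonneg_normed t)
          simpa [Real.dist_eq] using hF.dist_le_mul (x - t) (y - t)
      _ = L * dist x y := by rw [integral_mul_const, φ.integral_normed, one_mul]
  refine ⟨G, ?_, fun x => ?_, fun x => ?_⟩
  · exact φ.hasCompactSupport_normed.contDiff_convolution_left _ (φ.contDiff_normed)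
      (hF.continuous.locallyIntegrable)
  · exact norm_fderiv_le_of_lipschitz ℝ hLip
  · rw [← Real.dist_eq]
    refine φ.dist_normed_convolution_le hF.continuous.aestronglyMeasurable ?_
    intro y hy
    refine (hF.dist_le_mul y x).trans ?_
    gcongr
    exact (Metric.mem_ball.1 hy).le

theorem lintegral_exp_sub_le_of_lipschitzWith {F : E → ℝ} {L : NNReal} (hF : LipschitzWith L F)
    (s : ℝ) :
    ∫⁻ p, ENNReal.ofReal (Real.exp (s * (F p.2 - F p.1))) ∂((stdGaussian E).prod (stdGaussian E))
      ≤ ENNReal.ofReal (Real.exp (s ^ 2 * Real.pi ^ 2 * L ^ 2 / 8)) := by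
  set C : ℝ := s ^ 2 * Real.pi ^ 2 * L ^ 2 / 8
  -- Smoothing changes the difference by at most `2Lε`, a factor that tends to `1` with `ε`.
  have key : ∀ ε : ℝ, 0 < ε → ∫⁻ p, ENNReal.ofReal (Real.exp (s * (F p.2 - F p.1)))
      ∂((stdGaussian E).prod (stdGaussian E)) ≤ ENNReal.ofReal (Real.exp (2 * |s| * L * ε + C)) := by
    intro ε hε
    obtain ⟨G, hG, hG', hGF⟩ := exists_contDiff_dist_le_of_lipschitzWith hF hε
    calc _ ≤ ∫⁻ p, ENNReal.ofReal (Real.exp (2 * |s| * L * ε)) *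
          ENNReal.ofReal (Real.exp (s * (G p.2 - G p.1)))
            ∂((stdGaussian E).prod (stdGaussian E)) := by
          refine lintegral_mono fun p => ?_
          rw [← ENNReal.ofReal_mul (Real.exp_pos _).le, ← Real.exp_add]
          refine ENNReal.ofReal_le_ofReal (Real.exp_le_exp.2 ?_)
          have h1 : |(F p.2 - F p.1) - (G p.2 - G p.1)| ≤ 2 * (L * ε) := by
            have e1 := hGF p.1
            have e2 := hGF p.2
            rw [abs_le] at *
            constructor <;> linarith
          have h2 : s * ((F p.2 - F p.1) - (G p.2 - G p.1)) ≤ |s| * (2 * (L * ε)) := by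
            refine (le_abs_self _).trans ?_
            rw [abs_mul]
            gcongr
          linarith
      _ = ENNReal.ofReal (Real.exp (2 * |s| * L * ε)) * ∫⁻ p,
          ENNReal.ofReal (Real.exp (s * (G p.2 - G p.1)))
            ∂((stdGaussian E).prod (stdGaussian E)) := by
          refine lintegral_const_mul _ ?_
          have := hG.continuous
          exact (Continuous.measurable (by fun_prop)).ennreal_ofReal
      _ ≤ ENNReal.ofReal (Real.exp (2 * |s| * L * ε)) * ENNReal.ofReal (Real.exp C) := by
          gcongr
          exact lintegral_exp_sub_le_of_contDiff hG hG' s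
      _ = _ := by rw [← ENNReal.ofReal_mul (Real.exp_pos _).le, ← Real.exp_add]
  have hlim : Filter.Tendsto (fun ε : ℝ => ENNReal.ofReal (Real.exp (2 * |s| * L * ε + C)))
      (nhdsWithin 0 (Set.Ioi 0)) (nhds (ENNReal.ofReal (Real.exp C))) := by
    have hc : Continuous (fun ε : ℝ => ENNReal.ofReal (Real.exp (2 * |s| * L * ε + C))) :=
      ENNReal.continuous_ofReal.comp (by fun_prop)
    have := hc.tendsto 0
    simp only [mul_zero, zero_add] at this
    exact this.mono_left nhdsWithin_le_nhds
  exact ge_of_tendsto hlim (eventually_nhdsWithin_of_forall fun ε hε => key ε hε)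

end Gaussian

theorem integral_abs_gaussianReal : ∫ x, |x| ∂(gaussianReal 0 1) = √(2 / Real.pi) := by
  rw [integral_gaussianReal_eq_integral_smul one_ne_zero]
  have h1 : ∀ x : ℝ, gaussianPDFReal 0 1 x • |x|
      = (√(2 * Real.pi))⁻¹ * (fun y : ℝ => y ^ (1:ℝ) * Real.exp (-(1/2) * y ^ (2:ℝ))) |x| := by
    intro x
    simp only [gaussianPDFReal, smul_eq_mul, NNReal.coe_one, mul_one, sub_zero, Real.rpow_one,
      Real.rpow_two, sq_abs]
    ring_nf
  simp_rw [h1]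
  rw [integral_const_mul, integral_comp_abs (f := fun y : ℝ => y ^ (1:ℝ) * Real.exp (-(1/2) * y ^ (2:ℝ))),
    integral_rpow_mul_exp_neg_mul_rpow (by norm_num) (by norm_num) (by norm_num)]
  norm_num [Real.rpow_neg_one]
  have h2 : √(2:ℝ) * √2 = 2 := Real.mul_self_sqrt (by norm_num)
  have h3 : √(2:ℝ) ≠ 0 := by positivity
  have h4 : √Real.pi ≠ 0 := by positivity
  field_simp
  nlinarith

/-! ### Mean norm of a Gaussian vector and deviation from the mean -/

section RealGaussian

variable {E : Type*} [NormedAddCommGroup E] [InnerProductSpace ℝ E] [FiniteDimensional ℝ E]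
  [MeasurableSpace E] [BorelSpace E]

theorem integral_abs_dual_stdGaussian {ℓ : StrongDual ℝ E} (hℓ : ‖ℓ‖ = 1) :
    ∫ x, |ℓ x| ∂(stdGaussian E) = √(2 / Real.pi) := by
  have hmap := IsGaussian.map_eq_gaussianReal (μ := stdGaussian E) ℓ
  rw [integral_strongDual_stdGaussian, variance_dual_stdGaussian, hℓ] at hmap
  have : ∫ x, |ℓ x| ∂(stdGaussian E) = ∫ y, |y| ∂((stdGaussian E).map ℓ) := by
    rw [integral_map (by fun_prop) (by fun_prop)]
  rw [this, hmap]
  simpa using integral_abs_gaussianReal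

/-- Cauchy–Schwarz gives `∑ |xᵢ| ≤ √n ‖x‖`, and every coordinate has mean absolute value `√(2/π)`.
-/
theorem sqrt_mul_le_integral_norm_stdGaussian :
    √(finrank ℝ E) * √(2 / Real.pi) ≤ ∫ x, ‖x‖ ∂(stdGaussian E) := by
  set b := stdOrthonormalBasis ℝ E
  have hpt : ∀ x : E, ∑ i, |innerSL ℝ (b i) x| ≤ √(finrank ℝ E) * ‖x‖ := by
    intro x
    have h1 := Finset.sum_mul_sq_le_sq_mul_sq Finset.univ (fun _ : Fin (finrank ℝ E) => (1:ℝ))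
      (fun i => |innerSL ℝ (b i) x|)
    simp only [one_mul, one_pow, sq_abs, innerSL_apply_apply] at h1
    rw [b.sum_sq_inner_right] at h1
    simp only [Finset.sum_const, Finset.card_univ, Fintype.card_fin, nsmul_eq_mul, mul_one] at h1
    refine abs_le_of_sq_le_sq' ?_ (by positivity) |>.2
    rw [mul_pow, Real.sq_sqrt (by positivity)]
    simpa [innerSL_apply_apply] using h1
  have hint : Integrable (fun x : E => ‖x‖) (stdGaussian E) := IsGaussian.integrable_id.norm
  have hinti : ∀ i, Integrable (fun x : E => |innerSL ℝ (b i) x|) (stdGaussian E) := fun i =>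
    ((innerSL ℝ (b i)).integrable_comp IsGaussian.integrable_id).abs
  have h2 : ∫ x, ∑ i, |innerSL ℝ (b i) x| ∂(stdGaussian E)
      ≤ ∫ x, √(finrank ℝ E) * ‖x‖ ∂(stdGaussian E) :=
    integral_mono (integrable_finsetSum _ fun i _ => hinti i) (hint.const_mul _) hpt
  rw [integral_finsetSum _ fun i _ => hinti i, integral_const_mul] at h2
  have h3 : ∀ i, ∫ x, |innerSL ℝ (b i) x| ∂(stdGaussian E) = √(2 / Real.pi) := fun i =>
    integral_abs_dual_stdGaussian (by rw [innerSL_apply_norm, b.orthonormal.1 i])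
  simp only [h3, Finset.sum_const, Finset.card_univ, Fintype.card_fin, nsmul_eq_mul] at h2
  rcases Nat.eq_zero_or_pos (finrank ℝ E) with h0 | h0
  · rw [h0]; simp; exact integral_nonneg fun _ => norm_nonneg _
  · have hs : 0 < √(finrank ℝ E : ℝ) := by positivity
    have h4 : (finrank ℝ E : ℝ) = √(finrank ℝ E : ℝ) * √(finrank ℝ E : ℝ) :=
      (Real.mul_self_sqrt (by positivity)).symm
    rw [h4, mul_assoc] at h2
    rw [← h4] at h2
    exact le_of_mul_le_mul_left h2 hs

/-- Jensen in one of the two independent copies replaces that copy by its mean. -/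
theorem lintegral_exp_sub_integral_le_of_lipschitzWith {F : E → ℝ} {L : NNReal}
    (hF : LipschitzWith L F) (s : ℝ) :
    ∫⁻ x, ENNReal.ofReal (Real.exp (s * (F x - ∫ y, F y ∂(stdGaussian E)))) ∂(stdGaussian E)
      ≤ ENNReal.ofReal (Real.exp (s ^ 2 * Real.pi ^ 2 * L ^ 2 / 8)) := by
  refine le_trans ?_ (lintegral_exp_sub_le_of_lipschitzWith hF s)
  have hFc := hF.continuous
  have hint : Integrable F (stdGaussian E) := by
    refine Integrable.mono' (g := fun x => |F 0| + L * ‖x‖)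
      ((integrable_const _).add ((IsGaussian.integrable_id (μ := stdGaussian E)).norm.const_mul _))
      hFc.aestronglyMeasurable (Filter.Eventually.of_forall fun x => ?_)
    have := hF.dist_le_mul x 0
    rw [Real.dist_eq, dist_zero_right] at this
    rw [Real.norm_eq_abs]
    have h2 := abs_add_le (F x - F 0) (F 0)
    rw [sub_add_cancel] at h2
    linarith
  rw [lintegral_prod_symm _ ((Continuous.measurable (by fun_prop)).ennreal_ofReal.aemeasurable)]
  refine lintegral_mono fun x => ?_
  have h1 : Integrable (fun y => s * (F x - F y)) (stdGaussian E) :=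
    ((integrable_const _).sub hint).const_mul s
  have h2 := ofReal_exp_integral_le_lintegral _ h1
  rw [integral_const_mul, integral_sub (integrable_const _) hint] at h2
  simpa using h2

end RealGaussian

/-! ### Extending functions from the sphere -/

/-- The degree-one homogeneous extension of a function on the unit sphere. -/
def homogeneousExtension {E : Type*} [NormedAddCommGroup E] [NormedSpace ℂ E] (f : E → ℝ) (x : E) :
    ℝ :=
  ‖x‖ * f ((‖x‖⁻¹ : ℂ) • x)

section Homogeneous

variable {E : Type*} [NormedAddCommGroup E] [NormedSpace ℂ E] {f : E → ℝ}

theorem norm_inv_norm_smul {x : E} (hx : x ≠ 0) : ‖(‖x‖⁻¹ : ℂ) • x‖ = 1 := by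
  rw [norm_smul, norm_inv, Complex.norm_real, norm_norm, inv_mul_cancel₀ (norm_ne_zero_iff.2 hx)]

theorem homogeneousExtension_smul {x : E} (hx : ‖x‖ = 1) {r : ℝ} (hr : 0 ≤ r) :
    homogeneousExtension f ((r : ℂ) • x) = r * f x := by
  have h1 : ‖(r : ℂ) • x‖ = r := by
    rw [norm_smul, hx, mul_one, Complex.norm_real, Real.norm_of_nonneg hr]
  rcases hr.eq_or_lt with rfl | hr'
  · simp [homogeneousExtension]
  · rw [homogeneousExtension, h1, smul_smul, inv_mul_cancel₀ (by exact_mod_cast hr'.ne'), one_smul]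

/-- With unit directions `u, v`, the increment is `(‖x‖ - ‖y‖) f v + ‖x‖ (f u - f v)`. The radial
part costs `B`; the angular part costs `2K`, because `‖x‖ (u - v) = (x - y) + (‖y‖ - ‖x‖) v`. -/
theorem lipschitzWith_homogeneousExtension {K B : NNReal}
    (hK : ∀ x y : E, ‖x‖ = 1 → ‖y‖ = 1 → |f x - f y| ≤ K * ‖x - y‖)
    (hB : ∀ x : E, ‖x‖ = 1 → |f x| ≤ B) :
    LipschitzWith (B + 2 * K) (homogeneousExtension f) := by
  have hbd : ∀ x, |homogeneousExtension f x| ≤ B * ‖x‖ := by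
    intro x
    rcases eq_or_ne x 0 with rfl | hx
    · simp [homogeneousExtension]
    · rw [homogeneousExtension, abs_mul, abs_norm, mul_comm]
      gcongr
      exact hB _ (norm_inv_norm_smul hx)
  refine LipschitzWith.of_dist_le_mul fun x y => ?_
  rw [Real.dist_eq, dist_eq_norm]
  push_cast
  rcases eq_or_ne x 0 with rfl | hx
  · have := hbd y
    have h0 : homogeneousExtension f (0 : E) = 0 := by simp [homogeneousExtension]
    rw [h0, zero_sub, abs_neg, zero_sub, norm_neg]
    have : (0:ℝ) ≤ 2 * K * ‖y‖ := by positivity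
    linarith
  rcases eq_or_ne y 0 with rfl | hy
  · have := hbd x
    have h0 : homogeneousExtension f (0 : E) = 0 := by simp [homogeneousExtension]
    rw [h0, sub_zero, sub_zero]
    have : (0:ℝ) ≤ 2 * K * ‖x‖ := by positivity
    linarith
  set u := (‖x‖⁻¹ : ℂ) • x with hu
  set v := (‖y‖⁻¹ : ℂ) • y with hv
  have hu1 : ‖u‖ = 1 := norm_inv_norm_smul hx
  have hv1 : ‖v‖ = 1 := norm_inv_norm_smul hy
  have hxu : x = (‖x‖ : ℂ) • u := by
    rw [hu, smul_smul, mul_inv_cancel₀ (by exact_mod_cast norm_ne_zero_iff.2 hx), one_smul]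
  have hyv : y = (‖y‖ : ℂ) • v := by
    rw [hv, smul_smul, mul_inv_cancel₀ (by exact_mod_cast norm_ne_zero_iff.2 hy), one_smul]
  have hnn : |‖x‖ - ‖y‖| ≤ ‖x - y‖ := abs_norm_sub_norm_le x y
  have hkey : ‖x‖ * ‖u - v‖ ≤ 2 * ‖x - y‖ := by
    have e1 : ‖x‖ * ‖u - v‖ = ‖(‖x‖ : ℂ) • (u - v)‖ := by
      rw [norm_smul, Complex.norm_real, norm_norm]
    have e2 : (‖x‖ : ℂ) • (u - v) = (x - y) + ((‖y‖ - ‖x‖ : ℝ) : ℂ) • v := by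
      rw [smul_sub, ← hxu]
      push_cast
      rw [sub_smul, ← hyv]
      abel
    rw [e1, e2]
    refine (norm_add_le _ _).trans ?_
    rw [norm_smul, hv1, mul_one, Complex.norm_real, Real.norm_eq_abs, abs_sub_comm]
    linarith
  have e3 : homogeneousExtension f x - homogeneousExtension f y
      = (‖x‖ - ‖y‖) * f v + ‖x‖ * (f u - f v) := by
    simp only [homogeneousExtension, ← hu, ← hv]; ring
  rw [e3]
  calc _ ≤ |‖x‖ - ‖y‖| * |f v| + ‖x‖ * |f u - f v| := by
        refine (abs_add_le _ _).trans ?_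
        rw [abs_mul, abs_mul, abs_norm]
    _ ≤ ‖x - y‖ * B + ‖x‖ * (K * ‖u - v‖) := by
        gcongr
        · exact hB v hv1
        · exact hK u v hu1 hv1
    _ = ‖x - y‖ * B + K * (‖x‖ * ‖u - v‖) := by ring
    _ ≤ ‖x - y‖ * B + K * (2 * ‖x - y‖) := by gcongr
    _ = _ := by ring

end Homogeneous

/-! ### Haar measure on the unitary group and Lévy's lemma -/

section Unitary

variable {E : Type*} [NormedAddCommGroup E] [InnerProductSpace ℂ E] [FiniteDimensional ℂ E]

instance : CompactSpace (unitary (E →L[ℂ] E)) := by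
  have : ProperSpace (E →L[ℂ] E) := FiniteDimensional.proper ℂ _
  refine isCompact_iff_compactSpace.1 (Metric.isCompact_of_isClosed_isBounded isClosed_unitary ?_)
  refine (Metric.isBounded_closedBall (x := (0 : E →L[ℂ] E)) (r := 1)).subset fun u hu => ?_
  rw [mem_closedBall_zero_iff]
  exact u.opNorm_le_bound zero_le_one fun x => by rw [u.norm_map_of_mem_unitary hu, one_mul]

variable (E) in
/-- The Haar probability measure of the unitary group. -/
def haarUnitary : Measure (unitary (E →L[ℂ] E)) := Measure.haarMeasure ⊤

instance : Measure.IsHaarMeasure (haarUnitary E) := by unfold haarUnitary; infer_instance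

instance : IsProbabilityMeasure (haarUnitary E) :=
  ⟨by simpa [haarUnitary] using Measure.haarMeasure_self (K₀ := (⊤ : TopologicalSpace.PositiveCompacts
    (unitary (E →L[ℂ] E))))⟩

/-- A right translate of Haar measure is a Haar probability measure, so uniqueness applies. Right
invariance changes the vector being rotated; left invariance rotates the result. -/
instance : (haarUnitary E).IsMulRightInvariant where
  map_mul_right_eq_self g := by
    have : IsProbabilityMeasure ((haarUnitary E).map (· * g)) :=
      Measure.isProbabilityMeasure_map (measurable_mul_const g).aemeasurable
    exact Measure.isHaarMeasure_eq_of_isProbabilityMeasure _ _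

theorem exists_unitary_apply_eq {x y : E} (hx : ‖x‖ = 1) (hy : ‖y‖ = 1) :
    ∃ U : unitary (E →L[ℂ] E), (U : E →L[ℂ] E) x = y := by
  have hne : Nontrivial E := ⟨x, 0, fun h => by simp [h] at hx⟩
  have hpos : 0 < finrank ℂ E := finrank_pos
  let i : Fin (finrank ℂ E) := ⟨0, hpos⟩
  have hb : ∀ z : E, ‖z‖ = 1 → ∃ b : OrthonormalBasis (Fin (finrank ℂ E)) ℂ E, b i = z := by
    intro z hz
    obtain ⟨b, hb⟩ := Orthonormal.exists_orthonormalBasis_extension_of_card_eq (𝕜 := ℂ)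
      (ι := Fin (finrank ℂ E)) (by simp) (v := fun _ => z) (s := {i})
      ⟨fun _ => hz, fun a b hab => absurd (Subsingleton.elim a b) hab⟩
    exact ⟨b, hb i rfl⟩
  obtain ⟨b, hb1⟩ := hb x hx
  obtain ⟨c, hc1⟩ := hb y hy
  refine ⟨Unitary.linearIsometryEquiv.symm (b.equiv c (Equiv.refl _)), ?_⟩
  rw [← hb1, ← hc1]
  simp

theorem continuous_unitary_apply :
    Continuous fun q : unitary (E →L[ℂ] E) × E => (q.1 : E →L[ℂ] E) q.2 :=
  (continuous_subtype_val.comp continuous_fst).clm_apply continuous_snd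

theorem lintegral_haarUnitary_apply_eq {x y : E} (hx : ‖x‖ = 1) (hy : ‖y‖ = 1)
    (h : E → ENNReal) :
    ∫⁻ U, h ((U : E →L[ℂ] E) x) ∂(haarUnitary E) = ∫⁻ U, h ((U : E →L[ℂ] E) y) ∂(haarUnitary E) := by
  obtain ⟨V, rfl⟩ := exists_unitary_apply_eq hx hy
  exact (lintegral_mul_right_eq_self (fun U : unitary (E →L[ℂ] E) => h ((U : E →L[ℂ] E) x)) V).symm

theorem integral_haarUnitary_apply_eq {x y : E} (hx : ‖x‖ = 1) (hy : ‖y‖ = 1)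
    (h : E → ℝ) :
    ∫ U, h ((U : E →L[ℂ] E) x) ∂(haarUnitary E) = ∫ U, h ((U : E →L[ℂ] E) y) ∂(haarUnitary E) := by
  obtain ⟨V, rfl⟩ := exists_unitary_apply_eq hx hy
  exact (integral_mul_right_eq_self (fun U : unitary (E →L[ℂ] E) => h ((U : E →L[ℂ] E) x)) V).symm

theorem integral_haarUnitary_comp_unitary (x : E) (h : E → ℝ) (V : unitary (E →L[ℂ] E)) :
    ∫ U, h ((V : E →L[ℂ] E) ((U : E →L[ℂ] E) x)) ∂(haarUnitary E)
      = ∫ U, h ((U : E →L[ℂ] E) x) ∂(haarUnitary E) :=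
  integral_mul_left_eq_self (fun U : unitary (E →L[ℂ] E) => h ((U : E →L[ℂ] E) x)) V

theorem apply_eq_homogeneousExtension {f : E → ℝ} {x : E} (hx : ‖x‖ = 1)
    (U : unitary (E →L[ℂ] E)) :
    f ((U : E →L[ℂ] E) x) = homogeneousExtension f ((U : E →L[ℂ] E) x) := by
  have := homogeneousExtension_smul (f := f) (x := (U : E →L[ℂ] E) x)
    (by rw [Unitary.norm_map, hx]) zero_le_one
  simpa using this.symm

/-- The homogeneous extension of `f`, at a random rotation of `y`, is distributed as `‖y‖` times
`f` at a random rotation of any unit vector `x`. -/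
theorem lintegral_haarUnitary_homogeneousExtension {f : E → ℝ} {x : E} (hx : ‖x‖ = 1) (y : E)
    (h : ℝ → ENNReal) :
    ∫⁻ U, h (homogeneousExtension f ((U : E →L[ℂ] E) y)) ∂(haarUnitary E)
      = ∫⁻ U, h (‖y‖ * f ((U : E →L[ℂ] E) x)) ∂(haarUnitary E) := by
  rcases eq_or_ne y 0 with rfl | hy
  · simp [homogeneousExtension]
  have h1 := lintegral_haarUnitary_apply_eq (norm_inv_norm_smul hy) hx (fun z => h (‖y‖ * f z))
  rw [← h1]
  refine lintegral_congr fun U => ?_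
  rw [homogeneousExtension, Unitary.norm_map, map_smul]

theorem integral_haarUnitary_homogeneousExtension {f : E → ℝ} {x : E} (hx : ‖x‖ = 1) (y : E) :
    ∫ U, homogeneousExtension f ((U : E →L[ℂ] E) y) ∂(haarUnitary E)
      = ‖y‖ * ∫ U, f ((U : E →L[ℂ] E) x) ∂(haarUnitary E) := by
  rcases eq_or_ne y 0 with rfl | hy
  · simp [homogeneousExtension]
  have h1 := integral_haarUnitary_apply_eq (norm_inv_norm_smul hy) hx (fun z => ‖y‖ * f z)
  rw [← integral_const_mul, ← h1]
  refine integral_congr_ae (Filter.Eventually.of_forall fun U => ?_)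
  simp only [homogeneousExtension, Unitary.norm_map, map_smul]

variable {f : E → ℝ} {K B : NNReal}

/-- `f` is controlled only on the sphere, so continuity is read off its homogeneous extension. -/
theorem integrable_haarUnitary_apply
    (hK : ∀ x y : E, ‖x‖ = 1 → ‖y‖ = 1 → |f x - f y| ≤ K * ‖x - y‖)
    (hB : ∀ x : E, ‖x‖ = 1 → |f x| ≤ B) {x : E} (hx : ‖x‖ = 1) :
    Continuous (fun U : unitary (E →L[ℂ] E) => f ((U : E →L[ℂ] E) x)) ∧
    Integrable (fun U : unitary (E →L[ℂ] E) => f ((U : E →L[ℂ] E) x)) (haarUnitary E) := by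
  have hF := (lipschitzWith_homogeneousExtension hK hB).continuous
  have hc : Continuous (fun U : unitary (E →L[ℂ] E) => f ((U : E →L[ℂ] E) x)) := by
    simp_rw [apply_eq_homogeneousExtension (f := f) hx]
    exact hF.comp (continuous_unitary_apply.comp (continuous_id.prodMk continuous_const))
  exact ⟨hc, hc.integrable_of_hasCompactSupport (HasCompactSupport.of_compactSpace _)⟩

variable [MeasurableSpace E] [BorelSpace E]

variable (E) in
/-- The standard Gaussian measure of the underlying real inner product space. -/
def complexGaussian : Measure E :=
  letI : InnerProductSpace ℝ E := InnerProductSpace.complexToReal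
  stdGaussian E

instance : IsProbabilityMeasure (complexGaussian E) := by
  unfold complexGaussian; infer_instance

theorem complexGaussian_map_unitary (U : unitary (E →L[ℂ] E)) :
    (complexGaussian E).map (U : E →L[ℂ] E) = complexGaussian E := by
  let : InnerProductSpace ℝ E := InnerProductSpace.complexToReal
  let e : E ≃ₗᵢ[ℂ] E := Unitary.linearIsometryEquiv U
  let e' : E ≃ₗᵢ[ℝ] E := ⟨e.toLinearEquiv.restrictScalars ℝ, e.norm_map⟩
  exact stdGaussian_map e'

theorem integrable_norm_complexGaussian : Integrable (fun x : E => ‖x‖) (complexGaussian E) := by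
  let : InnerProductSpace ℝ E := InnerProductSpace.complexToReal
  exact (IsGaussian.integrable_id (μ := stdGaussian E)).norm

theorem le_integral_norm_complexGaussian :
    √(4 * finrank ℂ E / Real.pi) ≤ ∫ x, ‖x‖ ∂(complexGaussian E) := by
  let : InnerProductSpace ℝ E := InnerProductSpace.complexToReal
  have h := sqrt_mul_le_integral_norm_stdGaussian (E := E)
  rw [← Real.sqrt_mul (by positivity)] at h
  refine le_trans (le_of_eq ?_) h
  congr 1
  -- The real dimension is `2n`, hence `√(2n) √(2/π) = √(4n/π)`.
  have : finrank ℝ E = 2 * finrank ℂ E := finrank_real_of_complex E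
  rw [this]; push_cast; ring

theorem lintegral_exp_complexGaussian_le {F : E → ℝ} {L : NNReal} (hF : LipschitzWith L F)
    (s : ℝ) :
    ∫⁻ x, ENNReal.ofReal (Real.exp (s * (F x - ∫ y, F y ∂(complexGaussian E)))) ∂(complexGaussian E)
      ≤ ENNReal.ofReal (Real.exp (s ^ 2 * Real.pi ^ 2 * L ^ 2 / 8)) := by
  let : InnerProductSpace ℝ E := InnerProductSpace.complexToReal
  exact lintegral_exp_sub_integral_le_of_lipschitzWith hF s

/-- The Gaussian is unitarily invariant, so a Haar rotation may be inserted. After exchanging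
integrals, each fixed `y` contributes `‖y‖` times the spherical mean. -/
theorem integral_homogeneousExtension_complexGaussian
    (hK : ∀ x y : E, ‖x‖ = 1 → ‖y‖ = 1 → |f x - f y| ≤ K * ‖x - y‖)
    (hB : ∀ x : E, ‖x‖ = 1 → |f x| ≤ B) {x : E} (hx : ‖x‖ = 1) :
    ∫ y, homogeneousExtension f y ∂(complexGaussian E)
      = (∫ y, ‖y‖ ∂(complexGaussian E)) * ∫ U, f ((U : E →L[ℂ] E) x) ∂(haarUnitary E) := by
  have hF := (lipschitzWith_homogeneousExtension hK hB).continuous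
  have h1 : ∀ U : unitary (E →L[ℂ] E),
      ∫ y, homogeneousExtension f ((U : E →L[ℂ] E) y) ∂(complexGaussian E)
        = ∫ y, homogeneousExtension f y ∂(complexGaussian E) := by
    intro U
    conv_rhs => rw [← complexGaussian_map_unitary U]
    rw [integral_map (by fun_prop) (hF.aestronglyMeasurable)]
  have hint : Integrable (Function.uncurry fun (U : unitary (E →L[ℂ] E)) (y : E) =>
      homogeneousExtension f ((U : E →L[ℂ] E) y)) ((haarUnitary E).prod (complexGaussian E)) := by
    refine Integrable.mono' (g := fun q => B * ‖q.2‖)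
      ((integrable_norm_complexGaussian.comp_snd _).const_mul _)
      (hF.comp continuous_unitary_apply).aestronglyMeasurable
      (Filter.Eventually.of_forall fun q => ?_)
    have h0 : homogeneousExtension f (0 : E) = 0 := by simp [homogeneousExtension]
    rcases eq_or_ne q.2 0 with h | h
    · simp [Function.uncurry, h, h0]
    · simp only [Function.uncurry, homogeneousExtension, Unitary.norm_map, norm_mul, norm_norm]
      rw [mul_comm]
      gcongr
      refine hB _ ?_
      rw [← map_smul, Unitary.norm_map, norm_inv_norm_smul h]
  calc _ = ∫ U, ∫ y, homogeneousExtension f ((U : E →L[ℂ] E) y) ∂(complexGaussian E)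
          ∂(haarUnitary E) := by simp [h1]
    _ = ∫ y, ∫ U, homogeneousExtension f ((U : E →L[ℂ] E) y) ∂(haarUnitary E)
          ∂(complexGaussian E) := integral_integral_swap hint
    _ = _ := by
        simp_rw [integral_haarUnitary_homogeneousExtension hx]
        rw [integral_mul_const]

/-- Jensen in the radius: the mean norm in the exponent is replaced by the random `‖y‖`. Radius
times a uniform direction then recombines into the Gaussian, where the Lipschitz bound applies. -/
theorem lintegral_exp_haarUnitary_le
    (hK : ∀ x y : E, ‖x‖ = 1 → ‖y‖ = 1 → |f x - f y| ≤ K * ‖x - y‖)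
    (hB : ∀ x : E, ‖x‖ = 1 → |f x| ≤ B) {x : E} (hx : ‖x‖ = 1) (s : ℝ) :
    ∫⁻ U, ENNReal.ofReal (Real.exp (s * (∫ y, ‖y‖ ∂(complexGaussian E)) *
        (f ((U : E →L[ℂ] E) x) - ∫ V, f ((V : E →L[ℂ] E) x) ∂(haarUnitary E)))) ∂(haarUnitary E)
      ≤ ENNReal.ofReal (Real.exp (s ^ 2 * Real.pi ^ 2 * (B + 2 * K) ^ 2 / 8)) := by
  have hFl := lipschitzWith_homogeneousExtension hK hB
  have hF := hFl.continuous
  set F := homogeneousExtension f with hFdef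
  set m := ∫ y, ‖y‖ ∂(complexGaussian E) with hm
  set a := ∫ V, f ((V : E →L[ℂ] E) x) ∂(haarUnitary E) with ha
  have hEF : ∫ y, F y ∂(complexGaussian E) = m * a :=
    integral_homogeneousExtension_complexGaussian hK hB hx
  have hmain := lintegral_exp_complexGaussian_le hFl s
  rw [hEF] at hmain
  push_cast at hmain
  refine le_trans ?_ hmain
  let h : ℝ → ENNReal := fun t => ENNReal.ofReal (Real.exp (s * (t - m * a)))
  have hh : Continuous h := ENNReal.continuous_ofReal.comp (by fun_prop)
  have hfc := (integrable_haarUnitary_apply hK hB hx).1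
  have h1 : ∀ U : unitary (E →L[ℂ] E),
      ∫⁻ y, h (F ((U : E →L[ℂ] E) y)) ∂(complexGaussian E)
        = ∫⁻ y, h (F y) ∂(complexGaussian E) := by
    intro U
    conv_rhs => rw [← complexGaussian_map_unitary U]
    exact (lintegral_map (hh.comp hF).measurable (by fun_prop)).symm
  calc _ ≤ ∫⁻ U, ∫⁻ y, h (‖y‖ * f ((U : E →L[ℂ] E) x)) ∂(complexGaussian E) ∂(haarUnitary E) := by
        refine lintegral_mono fun U => ?_
        have hi : Integrable (fun y : E => s * (‖y‖ * f ((U : E →L[ℂ] E) x) - m * a))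
            (complexGaussian E) :=
          ((integrable_norm_complexGaussian.mul_const _).sub (integrable_const _)).const_mul _
        refine le_trans (le_of_eq ?_) (ofReal_exp_integral_le_lintegral _ hi)
        rw [integral_const_mul, integral_sub (integrable_norm_complexGaussian.mul_const _)
          (integrable_const _), integral_mul_const, ← hm]
        simp only [integral_const, probReal_univ, one_smul]
        congr 2; ring
    _ = ∫⁻ y, ∫⁻ U, h (‖y‖ * f ((U : E →L[ℂ] E) x)) ∂(haarUnitary E) ∂(complexGaussian E) := by
        refine lintegral_lintegral_swap ?_
        refine (hh.comp ?_).measurable.aemeasurable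
        exact continuous_snd.norm.mul (hfc.comp continuous_fst)
    _ = ∫⁻ y, ∫⁻ U, h (F ((U : E →L[ℂ] E) y)) ∂(haarUnitary E) ∂(complexGaussian E) := by
        refine lintegral_congr fun y => ?_
        exact (lintegral_haarUnitary_homogeneousExtension hx y h).symm
    _ = ∫⁻ U, ∫⁻ y, h (F ((U : E →L[ℂ] E) y)) ∂(complexGaussian E) ∂(haarUnitary E) := by
        refine (lintegral_lintegral_swap ?_).symm
        exact (hh.comp (hF.comp continuous_unitary_apply)).measurable.aemeasurable
    _ = _ := by simp [h1, h]

/-- **Lévy's lemma**: concentration of Lipschitz functions at a random unit vector. -/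
theorem haarUnitary_real_lt_apply_le
    (hK : ∀ x y : E, ‖x‖ = 1 → ‖y‖ = 1 → |f x - f y| ≤ K * ‖x - y‖)
    (hB : ∀ x : E, ‖x‖ = 1 → |f x| ≤ B) (hBK : 0 < B + 2 * K) {x : E} (hx : ‖x‖ = 1) {t : ℝ}
    (ht : 0 ≤ t) :
    (haarUnitary E).real {U | (∫ V, f ((V : E →L[ℂ] E) x) ∂(haarUnitary E)) + t
        < f ((U : E →L[ℂ] E) x)}
      ≤ Real.exp (-(8 * finrank ℂ E * t ^ 2 / (Real.pi ^ 3 * (B + 2 * K) ^ 2))) := by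
  have hm := le_integral_norm_complexGaussian (E := E)
  set m := ∫ y, ‖y‖ ∂(complexGaussian E) with hmdef
  set a := ∫ V, f ((V : E →L[ℂ] E) x) ∂(haarUnitary E) with ha
  have hm0 : 0 ≤ m := (Real.sqrt_nonneg _).trans hm
  have hm2 : 4 * finrank ℂ E / Real.pi ≤ m ^ 2 := by
    rw [← Real.sqrt_le_left hm0]; exact hm
  have hL : (0:ℝ) < B + 2 * K := by exact_mod_cast hBK
  set L : ℝ := B + 2 * K with hLdef
  have hpi := Real.pi_pos
  -- The minimizer of the Chernoff exponent `s²π²L²/8 - s m t`.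
  set s : ℝ := 4 * m * t / (Real.pi ^ 2 * L ^ 2) with hs
  have hs0 : 0 ≤ s := by positivity
  have hmain := lintegral_exp_haarUnitary_le hK hB hx s
  rw [← hmdef, ← ha] at hmain
  set S : Set (unitary (E →L[ℂ] E)) := {U | a + t < f ((U : E →L[ℂ] E) x)} with hS
  have hSm : MeasurableSet S :=
    (isOpen_lt continuous_const (integrable_haarUnitary_apply hK hB hx).1).measurableSet
  have h1 : ENNReal.ofReal (Real.exp (s * m * t)) * haarUnitary E S
      ≤ ENNReal.ofReal (Real.exp (s ^ 2 * Real.pi ^ 2 * L ^ 2 / 8)) := by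
    refine le_trans ?_ hmain
    rw [← setLIntegral_const]
    refine (setLIntegral_mono' hSm fun U hU => ?_).trans (setLIntegral_le_lintegral S _)
    refine ENNReal.ofReal_le_ofReal (Real.exp_le_exp.2 ?_)
    have : t ≤ f ((U : E →L[ℂ] E) x) - a := by
      have : a + t < f ((U : E →L[ℂ] E) x) := hU
      linarith
    gcongr
  have h2 : Real.exp (s * m * t) * (haarUnitary E).real S
      ≤ Real.exp (s ^ 2 * Real.pi ^ 2 * L ^ 2 / 8) := by
    have := ENNReal.toReal_mono ENNReal.ofReal_ne_top h1
    rwa [ENNReal.toReal_mul, ENNReal.toReal_ofReal (Real.exp_pos _).le,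
      ENNReal.toReal_ofReal (Real.exp_pos _).le] at this
  have h3 : (haarUnitary E).real S ≤ Real.exp (s ^ 2 * Real.pi ^ 2 * L ^ 2 / 8 - s * m * t) := by
    rw [Real.exp_sub, le_div_iff₀ (Real.exp_pos _), mul_comm]
    exact h2
  refine h3.trans (Real.exp_le_exp.2 ?_)
  have h4 : s ^ 2 * Real.pi ^ 2 * L ^ 2 / 8 - s * m * t
      = -(m ^ 2 * (2 * t ^ 2 / (Real.pi ^ 2 * L ^ 2))) := by
    rw [hs]; field_simp; ring
  have h5 : 8 * finrank ℂ E * t ^ 2 / (Real.pi ^ 3 * L ^ 2)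
      = (4 * finrank ℂ E / Real.pi) * (2 * t ^ 2 / (Real.pi ^ 2 * L ^ 2)) := by
    field_simp; ring
  rw [h4, h5]
  exact neg_le_neg (mul_le_mul_of_nonneg_right hm2 (by positivity))

end Unitary

/-! ### The trace norm and its duality with contractions -/

namespace RandomSubspace

section TraceNorm

variable {d : ℕ} (A : Matrix (Fin d) (Fin d) ℂ)

local notation "𝓗" => EuclideanSpace ℂ (Fin d)

/-- An eigenbasis of `A* A`: these are the right singular vectors, so their images are orthogonal.
-/
theorem exists_orthonormalBasis_inner_apply :
    ∃ b : OrthonormalBasis (Fin d) ℂ 𝓗, ∀ i j,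
      inner ℂ (Matrix.toEuclideanLin A (b i)) (Matrix.toEuclideanLin A (b j))
        = if i = j then (((Matrix.toEuclideanLin A).singularValues i : ℝ) : ℂ) ^ 2 else 0 := by
  set T := Matrix.toEuclideanLin A
  have hn : finrank ℂ 𝓗 = d := by simp
  refine ⟨T.isSymmetric_adjoint_comp_self.eigenvectorBasis hn, fun i j => ?_⟩
  rw [← LinearMap.adjoint_inner_right, ← LinearMap.comp_apply,
    T.isSymmetric_adjoint_comp_self.apply_eigenvectorBasis hn j, inner_smul_right,
    orthonormal_iff_ite.1 (T.isSymmetric_adjoint_comp_self.eigenvectorBasis hn).orthonormal,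
    ← T.sq_singularValues_fin hn]
  split_ifs with h
  · subst h; simp
  · simp

theorem traceNorm_eq_sum_fin :
    traceNorm A = ∑ i : Fin d, (Matrix.toEuclideanLin A).singularValues i := by
  rw [traceNorm, Finset.sum_range]

theorem traceNorm_nonneg : 0 ≤ traceNorm A :=
  Finset.sum_nonneg fun _ _ => LinearMap.singularValues_nonneg _ _

theorem norm_apply_eq_singularValues {b : OrthonormalBasis (Fin d) ℂ 𝓗}
    (hb : ∀ i j, inner ℂ (Matrix.toEuclideanLin A (b i)) (Matrix.toEuclideanLin A (b j))
        = if i = j then (((Matrix.toEuclideanLin A).singularValues i : ℝ) : ℂ) ^ 2 else 0)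
    (i : Fin d) : ‖Matrix.toEuclideanLin A (b i)‖ = (Matrix.toEuclideanLin A).singularValues i := by
  have h := hb i i
  rw [if_pos rfl, inner_self_eq_norm_sq_to_K] at h
  have h2 : ‖Matrix.toEuclideanLin A (b i)‖ ^ 2
      = (Matrix.toEuclideanLin A).singularValues i ^ 2 := by
    apply Complex.ofReal_injective
    push_cast
    exact h
  exact (pow_left_inj₀ (norm_nonneg _) (LinearMap.singularValues_nonneg _ _) two_ne_zero).1 h2

/-- In the right singular basis, the `i`-th diagonal entry of `M A` is at most `‖A bᵢ‖ = σᵢ` in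
modulus. -/
theorem re_trace_comp_le_traceNorm {M : 𝓗 →ₗ[ℂ] 𝓗} (hM : ∀ x, ‖M x‖ ≤ ‖x‖) :
    (LinearMap.trace ℂ 𝓗 (M ∘ₗ Matrix.toEuclideanLin A)).re ≤ traceNorm A := by
  obtain ⟨b, hb⟩ := exists_orthonormalBasis_inner_apply A
  rw [LinearMap.trace_eq_sum_inner _ b, Complex.re_sum, traceNorm_eq_sum_fin]
  refine Finset.sum_le_sum fun i _ => ?_
  rw [← norm_apply_eq_singularValues A hb i]
  refine (Complex.re_le_norm _).trans ((norm_inner_le_norm _ _).trans ?_)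
  rw [b.orthonormal.1 i, one_mul]
  exact hM _

theorem exists_contraction_trace_eq_traceNorm :
    ∃ M : 𝓗 →ₗ[ℂ] 𝓗, (∀ x, ‖M x‖ ≤ ‖x‖) ∧
      LinearMap.trace ℂ 𝓗 (M ∘ₗ Matrix.toEuclideanLin A) = traceNorm A := by
  obtain ⟨b, hb⟩ := exists_orthonormalBasis_inner_apply A
  set T := Matrix.toEuclideanLin A with hT
  set σ : Fin d → ℝ := fun i => T.singularValues i with hσ
  -- The adjoint of the partial isometry in the polar decomposition; the convention `0⁻¹ = 0` drops
  -- the zero singular values.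
  let M : 𝓗 →ₗ[ℂ] 𝓗 := ∑ i, ((σ i : ℂ)⁻¹) •
    ((innerSL ℂ (T (b i)) : 𝓗 →L[ℂ] ℂ) : 𝓗 →ₗ[ℂ] ℂ).smulRight (b i)
  have hMx : ∀ x, M x = ∑ i, ((σ i : ℂ)⁻¹ * inner ℂ (T (b i)) x) • b i := fun x => by
    simp [M, LinearMap.sum_apply, smul_smul]
  refine ⟨M, fun x => ?_, ?_⟩
  -- The normalized nonzero images are orthonormal, so contractivity is Bessel's inequality.
  · let s : Set (Fin d) := {i | σ i ≠ 0}
    let u : s → 𝓗 := fun i => (σ i : ℂ)⁻¹ • T (b i)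
    have hu : Orthonormal ℂ u := by
      rw [orthonormal_iff_ite]
      intro i j
      simp only [u, inner_smul_left, inner_smul_right, hb, Subtype.ext_iff]
      split_ifs with h
      · have h0 : (σ i : ℂ) ≠ 0 := by exact_mod_cast i.2
        rw [← h]
        simp only [map_inv₀, Complex.conj_ofReal]
        change (σ i : ℂ)⁻¹ * ((σ i : ℂ)⁻¹ * (σ i : ℂ) ^ 2) = 1
        field_simp
      · simp
    have hsum : ‖M x‖ ^ 2 = ∑ i, ‖(σ i : ℂ)⁻¹ * inner ℂ (T (b i)) x‖ ^ 2 := by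
      rw [← b.sum_sq_norm_inner_right]
      refine Finset.sum_congr rfl fun i _ => ?_
      rw [hMx, b.orthonormal.inner_right_fintype]
    have h1 : ∑ i, ‖(σ i : ℂ)⁻¹ * inner ℂ (T (b i)) x‖ ^ 2
        = ∑ i : s, ‖inner ℂ (u i) x‖ ^ 2 := by
      rw [← Finset.sum_subtype (Finset.univ.filter (· ∈ s)) (by simp)
        (fun i => ‖inner ℂ ((σ i : ℂ)⁻¹ • T (b i)) x‖ ^ 2), Finset.sum_filter_of_ne]
      · refine Finset.sum_congr rfl fun i _ => ?_
        rw [inner_smul_left, map_inv₀, Complex.conj_ofReal]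
      · intro i _ hi h0
        simp [show σ i = 0 from h0] at hi
    have h2 := hu.sum_inner_products_le x (s := Finset.univ)
    rw [← h1, ← hsum] at h2
    exact (pow_le_pow_iff_left₀ (norm_nonneg _) (norm_nonneg _) two_ne_zero).1 h2
  · rw [LinearMap.trace_eq_sum_inner _ b, traceNorm_eq_sum_fin]
    push_cast
    refine Finset.sum_congr rfl fun i _ => ?_
    rw [Function.comp_apply, hMx, inner_sum]
    simp only [inner_smul_right, hb, orthonormal_iff_ite.1 b.orthonormal]
    rw [Finset.sum_eq_single i]
    · simp only [if_true, mul_one]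
      change (σ i : ℂ)⁻¹ * (σ i : ℂ) ^ 2 = σ i
      by_cases h0 : σ i = 0
      · simp [h0]
      · have h0 : (σ i : ℂ) ≠ 0 := by exact_mod_cast h0
        field_simp
    · intro j _ hj; simp [hj]
    · simp

/-- Cauchy–Schwarz on the singular values; the sum of their squares is the trace of `A* A`, computed
in the standard basis. -/
theorem traceNorm_sq_le : traceNorm A ^ 2 ≤ d * ∑ i, ∑ j, ‖A i j‖ ^ 2 := by
  obtain ⟨b, hb⟩ := exists_orthonormalBasis_inner_apply A
  have hnorm := norm_apply_eq_singularValues A hb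
  set T := Matrix.toEuclideanLin A with hT
  have h1 : (∑ i : Fin d, T.singularValues i) ^ 2 ≤ d * ∑ i : Fin d, T.singularValues i ^ 2 := by
    simpa using sq_sum_le_card_mul_sum_sq (s := Finset.univ) (f := fun i : Fin d => T.singularValues i)
  rw [traceNorm_eq_sum_fin]
  refine h1.trans (le_of_eq ?_)
  congr 1
  have key : ∀ c : OrthonormalBasis (Fin d) ℂ 𝓗,
      LinearMap.trace ℂ 𝓗 (LinearMap.adjoint T ∘ₗ T) = ((∑ i, ‖T (c i)‖ ^ 2 : ℝ) : ℂ) := by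
    intro c
    rw [LinearMap.trace_eq_sum_inner _ c]
    push_cast
    refine Finset.sum_congr rfl fun i _ => ?_
    rw [Function.comp_apply, LinearMap.adjoint_inner_right, inner_self_eq_norm_sq_to_K]
    rfl
  have h2 : ∑ i, ‖T (b i)‖ ^ 2 = ∑ i, ‖T (EuclideanSpace.basisFun (Fin d) ℂ i)‖ ^ 2 := by
    exact_mod_cast (key b).symm.trans (key _)
  simp only [hnorm] at h2
  rw [h2, Finset.sum_comm]
  refine Finset.sum_congr rfl fun j _ => ?_
  rw [EuclideanSpace.norm_sq_eq]
  refine Finset.sum_congr rfl fun i _ => ?_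
  simp [hT, Matrix.toLpLin_apply, Matrix.mulVec_single]

end TraceNorm

/-! ### Lipschitz, uniform and purity bounds for the inaccuracy -/

variable {d₁ d₂ : ℕ}

/-- The trace distance between the reduced state of `ψ` on the first subsystem and the maximally
mixed state. -/
def inaccuracy₁ (ψ : Bipartite d₁ d₂) : ℝ :=
  traceDist (partialTrace₂ (density ψ)) (maxMixed d₁)

/-- The component of `ψ` along the `k`-th basis vector of the second subsystem. -/
def slice (ψ : Bipartite d₁ d₂) (k : Fin d₂) : EuclideanSpace ℂ (Fin d₁) :=
  WithLp.toLp 2 fun i => ψ (i, k)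

theorem slice_sub (ψ φ : Bipartite d₁ d₂) (k : Fin d₂) : slice (ψ - φ) k = slice ψ k - slice φ k := by
  ext i; simp [slice]

theorem sum_norm_slice_sq (ψ : Bipartite d₁ d₂) : ∑ k, ‖slice ψ k‖ ^ 2 = ‖ψ‖ ^ 2 := by
  simp only [EuclideanSpace.norm_sq_eq, slice]
  rw [Fintype.sum_prod_type, Finset.sum_comm]

theorem toEuclideanLin_partialTrace₂_density (ψ : Bipartite d₁ d₂) (x : EuclideanSpace ℂ (Fin d₁)) :
    Matrix.toEuclideanLin (partialTrace₂ (density ψ)) x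
      = ∑ k, inner ℂ (slice ψ k) x • slice ψ k := by
  ext i
  simp only [Matrix.toLpLin_apply, Matrix.mulVec, dotProduct, partialTrace₂, density, Matrix.of_apply,
    slice, PiLp.inner_apply, RCLike.inner_apply, WithLp.ofLp_sum, Finset.sum_apply, PiLp.smul_apply,
    smul_eq_mul, Finset.sum_mul]
  rw [Finset.sum_comm]
  refine Finset.sum_congr rfl fun k _ => Finset.sum_congr rfl fun j _ => ?_
  simp only [starRingEnd_apply]
  ring

theorem trace_comp_toEuclideanLin_partialTrace₂_density (ψ : Bipartite d₁ d₂)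
    (M : EuclideanSpace ℂ (Fin d₁) →ₗ[ℂ] EuclideanSpace ℂ (Fin d₁)) :
    LinearMap.trace ℂ _ (M ∘ₗ Matrix.toEuclideanLin (partialTrace₂ (density ψ)))
      = ∑ k, inner ℂ (slice ψ k) (M (slice ψ k)) := by
  set b := EuclideanSpace.basisFun (Fin d₁) ℂ
  rw [LinearMap.trace_eq_sum_inner _ b]
  simp only [LinearMap.coe_comp, Function.comp_apply, toEuclideanLin_partialTrace₂_density, map_sum,
    map_smul, inner_sum, inner_smul_right]
  rw [Finset.sum_comm]
  exact Finset.sum_congr rfl fun k _ => b.sum_inner_mul_inner _ _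

/-- The difference of the quadratic forms is `⟨ψ - φ, M ψ⟩ + ⟨φ, M (ψ - φ)⟩` slice by slice;
Cauchy–Schwarz over the slices bounds each term by `‖ψ - φ‖`. -/
theorem norm_trace_comp_sub_le (ψ φ : Bipartite d₁ d₂) (hψ : ‖ψ‖ = 1) (hφ : ‖φ‖ = 1)
    {M : EuclideanSpace ℂ (Fin d₁) →ₗ[ℂ] EuclideanSpace ℂ (Fin d₁)} (hM : ∀ x, ‖M x‖ ≤ ‖x‖) :
    ‖LinearMap.trace ℂ _ (M ∘ₗ Matrix.toEuclideanLin (partialTrace₂ (density ψ)))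
      - LinearMap.trace ℂ _ (M ∘ₗ Matrix.toEuclideanLin (partialTrace₂ (density φ)))‖
      ≤ 2 * ‖ψ - φ‖ := by
  have hCS : ∀ χ : Bipartite d₁ d₂, ‖χ‖ = 1 →
      ∑ k, ‖slice (ψ - φ) k‖ * ‖slice χ k‖ ≤ ‖ψ - φ‖ := by
    intro χ hχ
    refine abs_le_of_sq_le_sq' ?_ (norm_nonneg _) |>.2
    refine (Finset.sum_mul_sq_le_sq_mul_sq _ _ _).trans ?_
    rw [sum_norm_slice_sq, sum_norm_slice_sq, hχ]; simp
  rw [trace_comp_toEuclideanLin_partialTrace₂_density,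
    trace_comp_toEuclideanLin_partialTrace₂_density, ← Finset.sum_sub_distrib]
  calc _ ≤ ∑ k, ‖inner ℂ (slice ψ k) (M (slice ψ k)) - inner ℂ (slice φ k) (M (slice φ k))‖ :=
        norm_sum_le _ _
    _ ≤ ∑ k, (‖slice (ψ - φ) k‖ * ‖slice ψ k‖ + ‖slice (ψ - φ) k‖ * ‖slice φ k‖) := by
        refine Finset.sum_le_sum fun k _ => ?_
        have e : inner ℂ (slice ψ k) (M (slice ψ k)) - inner ℂ (slice φ k) (M (slice φ k))
            = inner ℂ (slice (ψ - φ) k) (M (slice ψ k))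
              + inner ℂ (slice φ k) (M (slice (ψ - φ) k)) := by
          rw [slice_sub, map_sub, inner_sub_left, inner_sub_right]; ring
        rw [e]
        refine (norm_add_le _ _).trans (add_le_add ?_ ?_)
        · exact (norm_inner_le_norm _ _).trans (by gcongr; exact hM _)
        · rw [mul_comm]
          exact (norm_inner_le_norm _ _).trans (by gcongr; exact hM _)
    _ ≤ _ := by
        rw [Finset.sum_add_distrib]
        linarith [hCS ψ hψ, hCS φ hφ]

/-- The contraction that is optimal for `A` serves as a test operator for `B`. -/
theorem traceNorm_sub_le_of_contraction {d : ℕ} {A B : Matrix (Fin d) (Fin d) ℂ} {c : ℝ}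
    (h : ∀ M : EuclideanSpace ℂ (Fin d) →ₗ[ℂ] EuclideanSpace ℂ (Fin d), (∀ x, ‖M x‖ ≤ ‖x‖) →
      ‖LinearMap.trace ℂ _ (M ∘ₗ Matrix.toEuclideanLin A)
        - LinearMap.trace ℂ _ (M ∘ₗ Matrix.toEuclideanLin B)‖ ≤ c) :
    traceNorm A - traceNorm B ≤ c := by
  obtain ⟨M, hM, hMA⟩ := exists_contraction_trace_eq_traceNorm A
  have h1 := re_trace_comp_le_traceNorm B hM
  have h2 := (Complex.re_le_norm _).trans (h M hM)
  rw [hMA, Complex.sub_re, Complex.ofReal_re] at h2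
  linarith

theorem abs_inaccuracy₁_sub_le (ψ φ : Bipartite d₁ d₂) (hψ : ‖ψ‖ = 1) (hφ : ‖φ‖ = 1) :
    |inaccuracy₁ ψ - inaccuracy₁ φ| ≤ 2 * ‖ψ - φ‖ := by
  have key : ∀ ψ φ : Bipartite d₁ d₂, ‖ψ‖ = 1 → ‖φ‖ = 1 →
      inaccuracy₁ ψ - inaccuracy₁ φ ≤ 2 * ‖ψ - φ‖ := by
    intro ψ φ hψ hφ
    refine traceNorm_sub_le_of_contraction fun M hM => ?_
    rw [map_sub, map_sub, LinearMap.comp_sub, LinearMap.comp_sub, map_sub, map_sub,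
      sub_sub_sub_cancel_right]
    exact norm_trace_comp_sub_le ψ φ hψ hφ hM
  rw [abs_le]
  have h1 := key ψ φ hψ hφ
  have h2 := key φ ψ hφ hψ
  rw [norm_sub_rev] at h2
  constructor <;> linarith

theorem inaccuracy₁_nonneg (ψ : Bipartite d₁ d₂) : 0 ≤ inaccuracy₁ ψ := traceNorm_nonneg _

theorem inaccuracy₁_le_two (ψ : Bipartite d₁ d₂) (hψ : ‖ψ‖ = 1) : inaccuracy₁ ψ ≤ 2 := by
  obtain ⟨M, hM, hMA⟩ := exists_contraction_trace_eq_traceNorm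
    (partialTrace₂ (density ψ) - maxMixed d₁)
  have h1 : ‖LinearMap.trace ℂ _ (M ∘ₗ Matrix.toEuclideanLin (partialTrace₂ (density ψ)))‖ ≤ 1 := by
    rw [trace_comp_toEuclideanLin_partialTrace₂_density]
    calc _ ≤ ∑ k, ‖inner ℂ (slice ψ k) (M (slice ψ k))‖ := norm_sum_le _ _
      _ ≤ ∑ k, ‖slice ψ k‖ ^ 2 := by
          refine Finset.sum_le_sum fun k _ => ?_
          rw [sq]
          exact (norm_inner_le_norm _ _).trans (by gcongr; exact hM _)
      _ = 1 := by rw [sum_norm_slice_sq, hψ, one_pow]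
  have h2 : ‖LinearMap.trace ℂ _ (M ∘ₗ Matrix.toEuclideanLin (maxMixed d₁))‖ ≤ 1 := by
    have e : M ∘ₗ Matrix.toEuclideanLin (maxMixed d₁) = (d₁ : ℂ)⁻¹ • M := by
      ext x
      simp [maxMixed]
    rw [e, map_smul, LinearMap.trace_eq_sum_inner _ (EuclideanSpace.basisFun (Fin d₁) ℂ), norm_smul]
    have h3 : ‖∑ i, inner ℂ (EuclideanSpace.basisFun (Fin d₁) ℂ i)
        (M (EuclideanSpace.basisFun (Fin d₁) ℂ i))‖ ≤ d₁ := by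
      refine (norm_sum_le _ _).trans ?_
      refine (Finset.sum_le_sum (g := fun _ => (1:ℝ)) fun i _ => ?_).trans (by simp)
      refine (norm_inner_le_norm _ _).trans ?_
      have := hM (EuclideanSpace.basisFun (Fin d₁) ℂ i)
      rw [(EuclideanSpace.basisFun (Fin d₁) ℂ).orthonormal.1 i] at this ⊢
      linarith
    rw [norm_inv, Complex.norm_natCast]
    rcases Nat.eq_zero_or_pos d₁ with h0 | h0
    · simp [h0]
    · have : (0:ℝ) < d₁ := by exact_mod_cast h0
      calc _ ≤ (d₁ : ℝ)⁻¹ * d₁ := by gcongr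
        _ = 1 := inv_mul_cancel₀ this.ne'
  have h3 : ((inaccuracy₁ ψ : ℝ) : ℂ) = LinearMap.trace ℂ _
        (M ∘ₗ Matrix.toEuclideanLin (partialTrace₂ (density ψ)))
      - LinearMap.trace ℂ _ (M ∘ₗ Matrix.toEuclideanLin (maxMixed d₁)) := by
    rw [inaccuracy₁, traceDist, ← hMA, map_sub, LinearMap.comp_sub, map_sub]
  have h4 : ‖((inaccuracy₁ ψ : ℝ) : ℂ)‖ ≤ 2 := by
    rw [h3]
    exact (norm_sub_le _ _).trans (by linarith)
  rwa [Complex.norm_real, Real.norm_of_nonneg (inaccuracy₁_nonneg ψ)] at h4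

/-- The purity of the reduced state of `ψ` on the first subsystem. -/
def purity₁ (ψ : Bipartite d₁ d₂) : ℝ := ∑ i, ∑ j, ‖partialTrace₂ (density ψ) i j‖ ^ 2

/-- Since the reduced state has trace one, its squared Frobenius distance to the maximally mixed
state is the purity minus `1/d₁`. -/
theorem inaccuracy₁_sq_le (hd : 0 < d₁) (ψ : Bipartite d₁ d₂) (hψ : ‖ψ‖ = 1) :
    inaccuracy₁ ψ ^ 2 ≤ d₁ * purity₁ ψ - 1 := by
  have hd' : (0:ℝ) < d₁ := by exact_mod_cast hd
  refine (traceNorm_sq_le _).trans (le_of_eq ?_)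
  set R := partialTrace₂ (density ψ) with hR
  have hdiag : ∀ i, (R i i).re = ∑ k, ‖ψ (i, k)‖ ^ 2 := by
    intro i
    simp only [hR, partialTrace₂, density, Matrix.of_apply, Complex.re_sum]
    refine Finset.sum_congr rfl fun k _ => ?_
    rw [← starRingEnd_apply, Complex.mul_conj, Complex.ofReal_re, Complex.normSq_eq_norm_sq]
  have htr : ∑ i, (R i i).re = 1 := by
    simp only [hdiag]
    rw [← Fintype.sum_prod_type (f := fun p : Fin d₁ × Fin d₂ => ‖ψ p‖ ^ 2),
      ← EuclideanSpace.norm_sq_eq, hψ, one_pow]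
  have hij : ∀ i j, ‖(R - maxMixed d₁) i j‖ ^ 2
      = ‖R i j‖ ^ 2 + if i = j then -2 * (d₁ : ℝ)⁻¹ * (R i i).re + ((d₁ : ℝ)⁻¹) ^ 2 else 0 := by
    intro i j
    by_cases h : i = j
    · subst h
      simp only [maxMixed, Matrix.sub_apply, Matrix.smul_apply, Matrix.one_apply_eq, smul_eq_mul,
        mul_one, if_true, ← Complex.normSq_eq_norm_sq, Complex.normSq_apply, Complex.sub_re,
        Complex.sub_im]
      have e : ((d₁ : ℂ)⁻¹) = (((d₁ : ℝ)⁻¹ : ℝ) : ℂ) := by push_cast; rfl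
      rw [e, Complex.ofReal_re, Complex.ofReal_im]
      ring
    · simp [maxMixed, Matrix.one_apply_ne h, h]
  simp only [hij, Finset.sum_add_distrib, Finset.sum_ite_eq, Finset.mem_univ, if_true,
    ← Finset.mul_sum, htr, Finset.sum_const, Finset.card_univ, Fintype.card_fin, nsmul_eq_mul]
  rw [purity₁, ← hR]
  field_simp
  ring

theorem purity₁_eq (ψ : Bipartite d₁ d₂) :
    purity₁ ψ = ∑ i, ∑ j, ∑ k, ∑ l,
      (ψ (i, k) * star (ψ (j, k)) * star (ψ (i, l)) * ψ (j, l)).re := by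
  refine Finset.sum_congr rfl fun i _ => Finset.sum_congr rfl fun j _ => ?_
  rw [← Complex.normSq_eq_norm_sq, ← Complex.ofReal_re (Complex.normSq _), ← Complex.mul_conj,
    partialTrace₂, Matrix.of_apply, map_sum, Finset.sum_mul_sum, Complex.re_sum]
  refine Finset.sum_congr rfl fun k _ => ?_
  rw [Complex.re_sum]
  refine Finset.sum_congr rfl fun l _ => ?_
  simp only [density, Matrix.of_apply, map_mul, starRingEnd_apply, star_star]
  ring_nf

end RandomSubspace

/-! ### Fourth moments of a random unit vector -/

section Moments

variable {ι : Type*} [Fintype ι] [DecidableEq ι]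

local notation "𝓔" => EuclideanSpace ℂ ι

/-- The expectation of `h` at a random unit vector, obtained by rotating `x`. -/
def sphereMean {E : Type*} [NormedAddCommGroup E] [InnerProductSpace ℂ E] [FiniteDimensional ℂ E]
    (x : E) (h : E → ℝ) : ℝ :=
  ∫ U, h ((U : E →L[ℂ] E) x) ∂(haarUnitary E)

section General

variable {E : Type*} [NormedAddCommGroup E] [InnerProductSpace ℂ E] [FiniteDimensional ℂ E]

theorem integrable_comp_unitary_apply {h : E → ℝ} (hh : Continuous h) (x : E) :
    Integrable (fun U : unitary (E →L[ℂ] E) => h ((U : E →L[ℂ] E) x)) (haarUnitary E) :=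
  (hh.comp (continuous_unitary_apply.comp
    (continuous_id.prodMk continuous_const))).integrable_of_hasCompactSupport
    (HasCompactSupport.of_compactSpace _)

theorem sphereMean_isometry (x : E) (h : E → ℝ) (V : E ≃ₗᵢ[ℂ] E) :
    sphereMean x (fun y => h (V y)) = sphereMean x h :=
  integral_haarUnitary_comp_unitary x h (Unitary.linearIsometryEquiv.symm V)

theorem sphereMean_add (x : E) {g h : E → ℝ} (hg : Continuous g) (hh : Continuous h) :
    sphereMean x (fun y => g y + h y) = sphereMean x g + sphereMean x h :=
  integral_add (integrable_comp_unitary_apply hg x) (integrable_comp_unitary_apply hh x)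

theorem sphereMean_sum (x : E) {κ : Type*} (s : Finset κ) {h : κ → E → ℝ}
    (hh : ∀ i, Continuous (h i)) :
    sphereMean x (fun y => ∑ i ∈ s, h i y) = ∑ i ∈ s, sphereMean x (h i) :=
  integral_finsetSum _ fun i _ => integrable_comp_unitary_apply (hh i) x

theorem sphereMean_const_mul (x : E) (c : ℝ) (h : E → ℝ) :
    sphereMean x (fun y => c * h y) = c * sphereMean x h :=
  integral_const_mul _ _

theorem sphereMean_congr {x : E} (hx : ‖x‖ = 1) {g h : E → ℝ} (hgh : ∀ y, ‖y‖ = 1 → g y = h y) :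
    sphereMean x g = sphereMean x h :=
  integral_congr_ae (Filter.Eventually.of_forall fun U => hgh _ (by rw [Unitary.norm_map, hx]))

theorem sphereMean_norm_inner_pow_eq (x : E) {v w : E} (hv : ‖v‖ = 1) (hw : ‖w‖ = 1) :
    sphereMean x (fun y => ‖inner ℂ v y‖ ^ 4) = sphereMean x (fun y => ‖inner ℂ w y‖ ^ 4) := by
  obtain ⟨V, rfl⟩ := exists_unitary_apply_eq hv hw
  rw [← sphereMean_isometry x (fun y => ‖inner ℂ ((V : E →L[ℂ] E) v) y‖ ^ 4)
    (Unitary.linearIsometryEquiv V)]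
  congr 1
  ext y
  exact congrArg (fun z => ‖z‖ ^ 4) (Unitary.inner_map_map V v y).symm

end General

/-- Summing over the fourth roots of unity cancels all phase-dependent terms. -/
theorem sum_norm_add_pow_four (a b : ℂ) :
    ‖a + b‖ ^ 4 + ‖a - b‖ ^ 4 + ‖a + Complex.I * b‖ ^ 4 + ‖a - Complex.I * b‖ ^ 4
      = 4 * ‖a‖ ^ 4 + 4 * ‖b‖ ^ 4 + 16 * (‖a‖ ^ 2 * ‖b‖ ^ 2) := by
  have h : ∀ z : ℂ, ‖z‖ ^ 4 = (z.re * z.re + z.im * z.im) ^ 2 := fun z => by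
    rw [← Complex.normSq_apply, Complex.normSq_eq_norm_sq]; ring
  have h' : ∀ z : ℂ, ‖z‖ ^ 2 = z.re * z.re + z.im * z.im := fun z => by
    rw [← Complex.normSq_apply, Complex.normSq_eq_norm_sq]
  simp only [h, h', Complex.add_re, Complex.add_im, Complex.sub_re, Complex.sub_im, Complex.mul_re,
    Complex.mul_im, Complex.I_re, Complex.I_im]
  ring

theorem sphereMean_norm_pow_four_eq (x : 𝓔) (a b : ι) :
    sphereMean x (fun y => ‖y a‖ ^ 4) = sphereMean x (fun y => ‖y b‖ ^ 4) := by
  have := sphereMean_norm_inner_pow_eq x (v := EuclideanSpace.single a (1:ℂ))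
    (w := EuclideanSpace.single b (1:ℂ)) (by simp) (by simp)
  simpa [EuclideanSpace.inner_single_left] using this

/-- Every unit vector has the same fourth moment `κ`. Testing four phases of `(e_a + ω̄ e_b)/√2`
yields `16κ = 8κ + 16m` for the mixed moment `m`. -/
theorem two_mul_sphereMean_norm_sq_mul_norm_sq (x : 𝓔) {a b : ι} (hab : a ≠ b) :
    2 * sphereMean x (fun y => ‖y a‖ ^ 2 * ‖y b‖ ^ 2) = sphereMean x (fun y => ‖y a‖ ^ 4) := by
  set κ := sphereMean x (fun y => ‖y a‖ ^ 4) with hκ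
  have hb : sphereMean x (fun y => ‖y b‖ ^ 4) = κ := sphereMean_norm_pow_four_eq x b a
  have hω : ∀ ω : ℂ, ‖ω‖ = 1 → sphereMean x (fun y => ‖y a + ω * y b‖ ^ 4) = 4 * κ := by
    intro ω hω
    let v : 𝓔 := ((√2)⁻¹ : ℂ) • (EuclideanSpace.single a (1:ℂ) + EuclideanSpace.single b (star ω))
    have h2 : ‖((√2 : ℝ) : ℂ)‖ = √2 := by rw [Complex.norm_real, Real.norm_of_nonneg (by positivity)]
    have hv : ‖v‖ = 1 := by
      rw [norm_smul, norm_inv, h2]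
      have : ‖EuclideanSpace.single a (1:ℂ) + EuclideanSpace.single b (star ω)‖ = √2 := by
        rw [eq_comm, Real.sqrt_eq_iff_mul_self_eq (by norm_num) (norm_nonneg _),
          norm_add_sq_eq_norm_sq_add_norm_sq_of_inner_eq_zero (𝕜 := ℂ)]
        · simp [hω]; norm_num
        · simp [EuclideanSpace.inner_single_left, hab]
      rw [this, inv_mul_cancel₀ (by positivity)]
    have h3 := sphereMean_norm_inner_pow_eq x hv (w := EuclideanSpace.single a (1:ℂ)) (by simp)
    have h4 : ∀ y : 𝓔, ‖y a + ω * y b‖ ^ 4 = 4 * ‖inner ℂ v y‖ ^ 4 := by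
      intro y
      have e : inner ℂ v y = ((√2)⁻¹ : ℂ) * (y a + ω * y b) := by
        simp [v, EuclideanSpace.inner_single_left]
        ring
      rw [e, norm_mul, norm_inv, h2, mul_pow, inv_pow]
      have : (√2 : ℝ) ^ 4 = 4 := by
        rw [show (4:ℕ) = 2 * 2 from rfl, pow_mul, Real.sq_sqrt (by norm_num)]; norm_num
      rw [this]; ring
    simp_rw [h4]
    rw [sphereMean_const_mul, h3]
    simp [EuclideanSpace.inner_single_left, hκ]
  have h1 := hω 1 (by simp)
  have h2 := hω (-1) (by simp)
  have h3 := hω Complex.I (by simp)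
  have h4 := hω (-Complex.I) (by simp)
  have key : sphereMean x (fun y : 𝓔 => ‖y a + 1 * y b‖ ^ 4 + ‖y a + -1 * y b‖ ^ 4
      + ‖y a + Complex.I * y b‖ ^ 4 + ‖y a + -Complex.I * y b‖ ^ 4)
      = sphereMean x (fun y : 𝓔 => 4 * ‖y a‖ ^ 4 + 4 * ‖y b‖ ^ 4 + 16 * (‖y a‖ ^ 2 * ‖y b‖ ^ 2)) := by
    congr 1
    ext y
    rw [← sum_norm_add_pow_four]
    simp only [one_mul, neg_mul, ← sub_eq_add_neg]
  rw [sphereMean_add x (by fun_prop) (by fun_prop), sphereMean_add x (by fun_prop) (by fun_prop),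
    sphereMean_add x (by fun_prop) (by fun_prop), sphereMean_add x (by fun_prop) (by fun_prop),
    sphereMean_add x (by fun_prop) (by fun_prop), sphereMean_const_mul, sphereMean_const_mul,
    sphereMean_const_mul, h1, h2, h3, h4, hb] at key
  linarith

/-- The moments are `κ` on the diagonal and `κ/2` off it; expanding `‖y‖⁴ = 1` fixes `κ =
2/(n(n+1))`. -/
theorem sphereMean_norm_sq_mul_norm_sq {x : 𝓔} (hx : ‖x‖ = 1) (a b : ι) :
    sphereMean x (fun y => ‖y a‖ ^ 2 * ‖y b‖ ^ 2)
      = (if a = b then 2 else 1) / (Fintype.card ι * (Fintype.card ι + 1)) := by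
  set κ := sphereMean x (fun y => ‖y a‖ ^ 4) with hκ
  have hκ' : ∀ c, sphereMean x (fun y => ‖y c‖ ^ 4) = κ := fun c => sphereMean_norm_pow_four_eq x c a
  have hall : ∀ c d : ι, sphereMean x (fun y => ‖y c‖ ^ 2 * ‖y d‖ ^ 2)
      = κ / 2 + if c = d then κ / 2 else 0 := by
    intro c d
    split_ifs with h
    · subst h
      rw [← hκ' c]
      simp_rw [← pow_add]
      ring
    · have := two_mul_sphereMean_norm_sq_mul_norm_sq x h
      rw [hκ' c] at this
      linarith
  have hsum : ∑ c : ι, ∑ d : ι, sphereMean x (fun y => ‖y c‖ ^ 2 * ‖y d‖ ^ 2) = 1 := by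
    have h1 : sphereMean x (fun y : 𝓔 => ∑ c : ι, ∑ d : ι, ‖y c‖ ^ 2 * ‖y d‖ ^ 2) = 1 := by
      rw [sphereMean_congr hx (h := fun _ => 1)]
      · simp [sphereMean]
      · intro y hy
        rw [← Finset.sum_mul_sum, ← EuclideanSpace.norm_sq_eq, hy]; norm_num
    rw [← h1, sphereMean_sum x _ fun c => by fun_prop]
    exact Finset.sum_congr rfl fun c _ => (sphereMean_sum x _ fun d => by fun_prop).symm
  simp only [hall, Finset.sum_add_distrib, Finset.sum_ite_eq, Finset.mem_univ, if_true,
    Finset.sum_const, Finset.card_univ, nsmul_eq_mul] at hsum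
  have hn : (0:ℝ) < Fintype.card ι := by exact_mod_cast Fintype.card_pos_iff.2 ⟨a⟩
  have hκv : κ = 2 / (Fintype.card ι * (Fintype.card ι + 1)) := by
    field_simp
    linarith
  rw [hall, hκv]
  split_ifs <;> ring

/-- Flipping the sign of coordinate `a` is unitary and negates the integrand. -/
theorem sphereMean_re_mul_eq_zero (x : 𝓔) {a b c d : ι} (hab : a ≠ b) (hac : a ≠ c) (had : a ≠ d) :
    sphereMean x (fun y => (y a * star (y b) * star (y c) * y d).re) = 0 := by
  let V : 𝓔 ≃ₗᵢ[ℂ] 𝓔 := LinearIsometryEquiv.piLpCongrRight 2 fun i =>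
    if i = a then LinearIsometryEquiv.neg ℂ else LinearIsometryEquiv.refl ℂ ℂ
  have hVa : ∀ y : 𝓔, V y a = - y a := fun y => by simp [V]
  have hV : ∀ (y : 𝓔) (i : ι), a ≠ i → V y i = y i := fun y i hi => by simp [V, hi.symm]
  have h1 := sphereMean_isometry x (fun y => (y a * star (y b) * star (y c) * y d).re) V
  have h2 : ∀ y : 𝓔, (V y a * star (V y b) * star (V y c) * V y d).re
      = (-1) * (y a * star (y b) * star (y c) * y d).re := by
    intro y
    rw [hVa, hV y b hab, hV y c hac, hV y d had]
    simp only [neg_mul, Complex.neg_re, one_mul]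
  simp_rw [h2] at h1
  rw [sphereMean_const_mul] at h1
  linarith

end Moments

/-! ### Mean purity and mean inaccuracy -/

namespace RandomSubspace

variable {d₁ d₂ : ℕ}

/-- Only index patterns with `i = j` or `k = l` survive, with weight two when both hold; they sum to
`d₁d₂(d₁ + d₂)` over `n(n+1)`, where `n = d₁d₂`. -/
theorem sphereMean_purity₁ (h₁ : 0 < d₁) (h₂ : 0 < d₂) {x : Bipartite d₁ d₂} (hx : ‖x‖ = 1) :
    sphereMean x purity₁ = ((d₁ : ℝ) + d₂) / (d₁ * d₂ + 1) := by
  have hterm : ∀ (i j : Fin d₁) (k l : Fin d₂),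
      sphereMean x (fun ψ => (ψ (i, k) * star (ψ (j, k)) * star (ψ (i, l)) * ψ (j, l)).re)
        = ((if i = j then 1 else 0) + if k = l then 1 else 0) / ((d₁ * d₂ : ℝ) * (d₁ * d₂ + 1)) := by
    intro i j k l
    have hn : (Fintype.card (Fin d₁ × Fin d₂) : ℝ) = d₁ * d₂ := by simp
    have hsq : ∀ z w : ℂ, (z * star z * star w * w).re = ‖z‖ ^ 2 * ‖w‖ ^ 2 := by
      intro z w
      rw [mul_assoc (z * star z), mul_comm (star w), ← starRingEnd_apply, ← starRingEnd_apply,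
        Complex.mul_conj, Complex.mul_conj, ← Complex.ofReal_mul, Complex.ofReal_re,
        Complex.normSq_eq_norm_sq, Complex.normSq_eq_norm_sq]
    by_cases hij : i = j
    · subst hij
      simp_rw [hsq]
      rw [sphereMean_norm_sq_mul_norm_sq hx, hn]
      by_cases hkl : k = l
      · subst hkl; norm_num
      · simp [hkl]
    · by_cases hkl : k = l
      · subst hkl
        have : ∀ z w : ℂ, (z * star w * star z * w).re = ‖z‖ ^ 2 * ‖w‖ ^ 2 := fun z w => by
          rw [← hsq]; ring_nf
        simp_rw [this]
        rw [sphereMean_norm_sq_mul_norm_sq hx, hn]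
        simp [hij]
      · rw [sphereMean_re_mul_eq_zero x (by simp [hij]) (by simp [hkl]) (by simp [hij])]
        simp [hij, hkl]
  have hpt : (purity₁ : Bipartite d₁ d₂ → ℝ) = fun ψ => ∑ i, ∑ j, ∑ k, ∑ l,
      (ψ (i, k) * star (ψ (j, k)) * star (ψ (i, l)) * ψ (j, l)).re := funext purity₁_eq
  have hc : ∀ (i j : Fin d₁) (k l : Fin d₂), Continuous fun ψ : Bipartite d₁ d₂ =>
      (ψ (i, k) * star (ψ (j, k)) * star (ψ (i, l)) * ψ (j, l)).re := fun i j k l =>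
    Complex.continuous_re.comp (by fun_prop)
  rw [hpt, sphereMean_sum x _ fun i => continuous_finsetSum _ fun j _ =>
    continuous_finsetSum _ fun k _ => continuous_finsetSum _ fun l _ => hc i j k l]
  have step : ∀ i : Fin d₁, sphereMean x (fun ψ => ∑ j, ∑ k, ∑ l,
      (ψ (i, k) * star (ψ (j, k)) * star (ψ (i, l)) * ψ (j, l)).re)
      = ∑ j : Fin d₁, ∑ k : Fin d₂, ∑ l : Fin d₂,
        ((if i = j then 1 else 0) + if k = l then 1 else 0) / ((d₁ * d₂ : ℝ) * (d₁ * d₂ + 1)) := by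
    intro i
    rw [sphereMean_sum x _ fun j => continuous_finsetSum _ fun k _ =>
      continuous_finsetSum _ fun l _ => hc i j k l]
    refine Finset.sum_congr rfl fun j _ => ?_
    rw [sphereMean_sum x _ fun k => continuous_finsetSum _ fun l _ => hc i j k l]
    refine Finset.sum_congr rfl fun k _ => ?_
    rw [sphereMean_sum x _ fun l => hc i j k l]
    exact Finset.sum_congr rfl fun l _ => hterm i j k l
  simp only [step, ← Finset.sum_div, Finset.sum_add_distrib, Finset.sum_const, Finset.card_univ,
    Fintype.card_fin, nsmul_eq_mul, Finset.sum_ite_eq, Finset.mem_univ, if_true, ← Finset.mul_sum]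
  have h1 : (0:ℝ) < d₁ := by exact_mod_cast h₁
  have h2 : (0:ℝ) < d₂ := by exact_mod_cast h₂
  field_simp
  ring

theorem continuous_inaccuracy₁_unitary {x : Bipartite d₁ d₂} (hx : ‖x‖ = 1) :
    Continuous (fun U : unitary (Bipartite d₁ d₂ →L[ℂ] Bipartite d₁ d₂) =>
      inaccuracy₁ ((U : Bipartite d₁ d₂ →L[ℂ] Bipartite d₁ d₂) x)) :=
  (integrable_haarUnitary_apply (K := 2) (B := 2) (fun ψ φ => abs_inaccuracy₁_sub_le ψ φ)
    (fun ψ hψ => by rw [abs_of_nonneg (inaccuracy₁_nonneg ψ)]; exact inaccuracy₁_le_two ψ hψ) hx).1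

theorem sphereMean_inaccuracy₁_le (h₁ : 0 < d₁) (h₂ : 0 < d₂) {x : Bipartite d₁ d₂}
    (hx : ‖x‖ = 1) :
    sphereMean x inaccuracy₁ ≤ √(((d₁ : ℝ) ^ 2 - 1) / ((d₁ : ℝ) * d₂ + 1)) := by
  have hc := continuous_inaccuracy₁_unitary hx
  have hpc : Continuous (purity₁ : Bipartite d₁ d₂ → ℝ) := by
    unfold purity₁ partialTrace₂ density
    simp only [Matrix.of_apply]
    fun_prop
  have hint : Integrable (fun U : unitary (Bipartite d₁ d₂ →L[ℂ] Bipartite d₁ d₂) =>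
      inaccuracy₁ ((U : Bipartite d₁ d₂ →L[ℂ] Bipartite d₁ d₂) x)) (haarUnitary _) :=
    hc.integrable_of_hasCompactSupport (HasCompactSupport.of_compactSpace _)
  have hint2 : Integrable (fun U : unitary (Bipartite d₁ d₂ →L[ℂ] Bipartite d₁ d₂) =>
      inaccuracy₁ ((U : Bipartite d₁ d₂ →L[ℂ] Bipartite d₁ d₂) x) ^ 2) (haarUnitary _) :=
    (hc.pow 2).integrable_of_hasCompactSupport (HasCompactSupport.of_compactSpace _)
  set a := sphereMean x inaccuracy₁ with ha
  -- Nonnegativity of the variance passes from the mean to the second moment, which the purity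
  -- controls.
  have hvar : a ^ 2 ≤ ∫ U, inaccuracy₁ ((U : Bipartite d₁ d₂ →L[ℂ] Bipartite d₁ d₂) x) ^ 2
      ∂(haarUnitary (Bipartite d₁ d₂)) := by
    have h0 : ∫ U, (inaccuracy₁ ((U : Bipartite d₁ d₂ →L[ℂ] Bipartite d₁ d₂) x) ^ 2
        - (2 * a) * inaccuracy₁ ((U : Bipartite d₁ d₂ →L[ℂ] Bipartite d₁ d₂) x))
        ∂(haarUnitary (Bipartite d₁ d₂)) ≥ ∫ _, (-a ^ 2) ∂(haarUnitary (Bipartite d₁ d₂)) := by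
      refine integral_mono (integrable_const _) (hint2.sub (hint.const_mul _)) fun U => ?_
      dsimp only
      nlinarith [sq_nonneg (inaccuracy₁ ((U : Bipartite d₁ d₂ →L[ℂ] Bipartite d₁ d₂) x) - a)]
    rw [integral_sub hint2 (hint.const_mul _), integral_const_mul] at h0
    have h1 : ∫ U, inaccuracy₁ ((U : Bipartite d₁ d₂ →L[ℂ] Bipartite d₁ d₂) x) ∂(haarUnitary (Bipartite d₁ d₂))
        = a := rfl
    rw [h1] at h0
    simp only [integral_const, probReal_univ, one_smul] at h0
    nlinarith
  have hle : ∫ U, inaccuracy₁ ((U : Bipartite d₁ d₂ →L[ℂ] Bipartite d₁ d₂) x) ^ 2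
      ∂(haarUnitary (Bipartite d₁ d₂)) ≤ d₁ * sphereMean x purity₁ - 1 := by
    have hpi := integrable_comp_unitary_apply hpc x
    have h2 : ∫ U, inaccuracy₁ ((U : Bipartite d₁ d₂ →L[ℂ] Bipartite d₁ d₂) x) ^ 2
        ∂(haarUnitary (Bipartite d₁ d₂)) ≤ ∫ U, (d₁ * purity₁ ((U : Bipartite d₁ d₂ →L[ℂ] Bipartite d₁ d₂) x) - 1)
        ∂(haarUnitary (Bipartite d₁ d₂)) :=
      integral_mono hint2 ((hpi.const_mul _).sub (integrable_const _)) fun U =>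
        inaccuracy₁_sq_le h₁ _ (by rw [Unitary.norm_map, hx])
    rw [integral_sub (hpi.const_mul _) (integrable_const _), integral_const_mul] at h2
    simpa [sphereMean] using h2
  refine Real.le_sqrt_of_sq_le (hvar.trans (hle.trans (le_of_eq ?_)))
  rw [sphereMean_purity₁ h₁ h₂ hx]
  have h1 : (0:ℝ) < d₁ := by exact_mod_cast h₁
  have h2 : (0:ℝ) < d₂ := by exact_mod_cast h₂
  field_simp
  ring

end RandomSubspace

/-! ### Nets of unit vectors -/

section Net

variable {V : Type*} [NormedAddCommGroup V] [NormedSpace ℝ V] [FiniteDimensional ℝ V]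

open scoped Function in
-- Volume comparison: disjoint balls of radius `δ/2` around the points lie in the ball of radius `1
-- + δ/2`.
theorem card_le_of_separated_unit_vectors {δ : ℝ} (hδ : 0 < δ) (s : Finset V)
    (hs : ∀ c ∈ s, ‖c‖ = 1) (h : ∀ c ∈ s, ∀ d ∈ s, c ≠ d → δ ≤ ‖c - d‖) :
    (s.card : ℝ) ≤ (1 + 2 / δ) ^ finrank ℝ V := by
  borelize V
  let μ : Measure V := Measure.addHaar
  have hδ2 : 0 < δ / 2 := by positivity
  have hρ : 0 < 1 + δ / 2 := by positivity
  have D : Set.Pairwise (s : Set V) (Disjoint on fun c => Metric.ball (c : V) (δ / 2)) := by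
    rintro c hc d hd hcd
    apply Metric.ball_disjoint_ball
    rw [dist_eq_norm]
    linarith [h c hc d hd hcd]
  have hsub : (⋃ c ∈ s, Metric.ball (c : V) (δ / 2)) ⊆ Metric.ball (0 : V) (1 + δ / 2) := by
    refine Set.iUnion₂_subset fun x hx => Metric.ball_subset_ball' ?_
    rw [dist_zero_right, hs x hx, add_comm]
  have I : (s.card : ENNReal) * ENNReal.ofReal ((δ / 2) ^ finrank ℝ V) * μ (Metric.ball 0 1) ≤
      ENNReal.ofReal ((1 + δ / 2) ^ finrank ℝ V) * μ (Metric.ball 0 1) :=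
    calc _ = μ (⋃ c ∈ s, Metric.ball (c : V) (δ / 2)) := by
          rw [measure_biUnion_finset D fun c _ => measurableSet_ball]
          simp only [μ.addHaar_ball_of_pos _ hδ2, Finset.sum_const, nsmul_eq_mul, mul_assoc]
      _ ≤ μ (Metric.ball (0 : V) (1 + δ / 2)) := measure_mono hsub
      _ = _ := by simp only [μ.addHaar_ball_of_pos _ hρ]
  have J := (ENNReal.mul_le_mul_iff_left (Metric.measure_ball_pos _ _ zero_lt_one).ne'
    measure_ball_lt_top.ne).1 I
  have K := ENNReal.toReal_le_of_le_ofReal (by positivity) J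
  rw [ENNReal.toReal_mul, ENNReal.toReal_ofReal (by positivity), ENNReal.toReal_natCast,
    ← le_div_iff₀ (by positivity), ← div_pow] at K
  refine K.trans (le_of_eq ?_)
  congr 1
  field_simp
  ring

/-- A separated set of maximal size is a net, since an uncovered unit vector could be added. -/
theorem exists_net_unit_vectors (V : Type*) [NormedAddCommGroup V] [NormedSpace ℝ V]
    [FiniteDimensional ℝ V] {δ : ℝ} (hδ : 0 < δ) :
    ∃ s : Finset V, (∀ c ∈ s, ‖c‖ = 1) ∧ (∀ y : V, ‖y‖ = 1 → ∃ c ∈ s, ‖y - c‖ < δ) ∧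
      (s.card : ℝ) ≤ (1 + 2 / δ) ^ finrank ℝ V := by
  classical
  let S : Set ℕ := {N | ∃ s : Finset V, s.card = N ∧ (∀ c ∈ s, ‖c‖ = 1) ∧
    ∀ c ∈ s, ∀ d ∈ s, c ≠ d → δ ≤ ‖c - d‖}
  have hne : S.Nonempty := ⟨0, ∅, by simp⟩
  have hbd : BddAbove S := by
    refine ⟨⌊(1 + 2 / δ) ^ finrank ℝ V⌋₊, ?_⟩
    rintro _ ⟨s, rfl, h1, h2⟩
    exact Nat.le_floor (card_le_of_separated_unit_vectors hδ s h1 h2)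
  obtain ⟨s, hcard, h1, h2⟩ := Nat.sSup_mem hne hbd
  refine ⟨s, h1, fun y hy => ?_, card_le_of_separated_unit_vectors hδ s h1 h2⟩
  by_contra! hcon
  have hys : y ∉ s := fun h => by
    have := hcon y h
    simp at this
    linarith
  have hmem : (insert y s).card ∈ S := by
    refine ⟨insert y s, rfl, ?_, ?_⟩
    · simpa [hy] using h1
    · intro c hc d hd hcd
      rw [Finset.mem_insert] at hc hd
      rcases hc with rfl | hc <;> rcases hd with rfl | hd
      · exact absurd rfl hcd
      · exact hcon d hd
      · rw [norm_sub_rev]; exact hcon c hc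
      · exact h2 c hc d hd hcd
  have h3 := le_csSup hbd hmem
  rw [Finset.card_insert_of_notMem hys, hcard] at h3
  omega

end Net

/-! ### Random subspaces and the union bound -/

namespace RandomSubspace

section Grassmannian

variable {E : Type*} [NormedAddCommGroup E] [InnerProductSpace ℂ E] [FiniteDimensional ℂ E]
  {k : ℕ}

/-- Makes open sets of unitary–subspace pairs measurable for the product σ-algebra, as Tonelli's
theorem needs. -/
instance : SecondCountableTopology (Gr E k) := by
  have : ProperSpace (E →L[ℂ] E) := FiniteDimensional.proper ℂ _
  exact TopologicalSpace.secondCountableTopology_induced _ _ Gr.proj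

theorem Gr.continuous_proj : Continuous (Gr.proj : Gr E k → E →L[ℂ] E) := continuous_induced_dom

theorem Gr.proj_mem (W : Gr E k) (ψ : E) : W.proj ψ ∈ W.1 := W.1.starProjection_apply_mem ψ

theorem Gr.proj_eq_self {W : Gr E k} {ψ : E} (hψ : ψ ∈ W.1) : W.proj ψ = ψ :=
  Submodule.starProjection_eq_self_iff.2 hψ

/-- The subspaces containing a vector `v` with `c * ‖v‖ < F v`. -/
def Gr.exceed (F : E → ℝ) (c : ℝ) : Set (Gr E k) := {W | ∃ v ∈ W.1, c * ‖v‖ < F v}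

/-- Every vector of `W` is its own projection, so the vector ranging over the varying `W` becomes
`W.proj ψ`, continuous in `W`, with `ψ` in a fixed space. -/
theorem Gr.exceed_eq_iUnion (F : E → ℝ) (c : ℝ) :
    (Gr.exceed F c : Set (Gr E k)) = ⋃ ψ : E, {W | c * ‖W.proj ψ‖ < F (W.proj ψ)} := by
  ext W
  simp only [Gr.exceed, Set.mem_ofPred_eq, Set.mem_iUnion]
  refine ⟨fun ⟨v, hv, h⟩ => ⟨v, ?_⟩, fun ⟨ψ, h⟩ => ⟨_, W.proj_mem ψ, h⟩⟩
  rwa [Gr.proj_eq_self hv]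

theorem Gr.isOpen_exceed {F : E → ℝ} (hF : Continuous F) (c : ℝ) :
    IsOpen (Gr.exceed F c : Set (Gr E k)) := by
  rw [Gr.exceed_eq_iUnion]
  refine isOpen_iUnion fun ψ => ?_
  have hc : Continuous fun W : Gr E k => W.proj ψ := Gr.continuous_proj.clm_apply continuous_const
  exact isOpen_lt (continuous_const.mul hc.norm) (hF.comp hc)

/-- The pairs of a unitary operator and a subspace such that the image subspace is in
`Gr.exceed F c`. -/
def Gr.exceedPair (F : E → ℝ) (c : ℝ) : Set (unitary (E →L[ℂ] E) × Gr E k) :=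
  {q | ∃ v ∈ q.2.1, c * ‖v‖ < F ((q.1 : E →L[ℂ] E) v)}

theorem Gr.isOpen_exceedPair {F : E → ℝ} (hF : Continuous F) (c : ℝ) :
    IsOpen (Gr.exceedPair F c : Set (unitary (E →L[ℂ] E) × Gr E k)) := by
  have : (Gr.exceedPair F c : Set (unitary (E →L[ℂ] E) × Gr E k))
      = ⋃ ψ : E, {q | c * ‖q.2.proj ψ‖ < F ((q.1 : E →L[ℂ] E) (q.2.proj ψ))} := by
    ext q
    simp only [Gr.exceedPair, Set.mem_ofPred_eq, Set.mem_iUnion]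
    refine ⟨fun ⟨v, hv, h⟩ => ⟨v, ?_⟩, fun ⟨ψ, h⟩ => ⟨_, q.2.proj_mem ψ, h⟩⟩
    rwa [Gr.proj_eq_self hv]
  rw [this]
  refine isOpen_iUnion fun ψ => ?_
  have hc : Continuous fun q : unitary (E →L[ℂ] E) × Gr E k => q.2.proj ψ :=
    (Gr.continuous_proj.comp continuous_snd).clm_apply continuous_const
  exact isOpen_lt (continuous_const.mul hc.norm)
    (hF.comp ((continuous_subtype_val.comp continuous_fst).clm_apply hc))

theorem Gr.preimage_unitaryMap_exceed (F : E → ℝ) (c : ℝ) (U : unitary (E →L[ℂ] E)) :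
    Gr.unitaryMap (Unitary.linearIsometryEquiv U) ⁻¹' (Gr.exceed F c : Set (Gr E k))
      = {W | (U, W) ∈ Gr.exceedPair F c} := by
  ext W
  simp only [Set.mem_preimage, Gr.exceed, Gr.exceedPair, Gr.unitaryMap, Set.mem_ofPred_eq]
  constructor
  · rintro ⟨_, ⟨v, hv, rfl⟩, h⟩
    refine ⟨v, hv, ?_⟩
    have h1 : ‖(U : E →L[ℂ] E) v‖ = ‖v‖ := Unitary.norm_map U v
    rw [← h1]
    exact h
  · rintro ⟨v, hv, h⟩
    refine ⟨_, ⟨v, hv, rfl⟩, ?_⟩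
    have h1 : ‖(U : E →L[ℂ] E) v‖ = ‖v‖ := Unitary.norm_map U v
    rw [← h1] at h
    exact h

/-- A uniformly random subspace can be realized by applying a Haar random unitary operator to a
subspace, so that a bound for a random rotation of each subspace holds for the random subspace. -/
theorem Gr.IsUniform.measure_exceed_le {μ : Measure (Gr E k)} (hμ : Gr.IsUniform μ) {F : E → ℝ}
    (hF : Continuous F) (c : ℝ) {b : ENNReal}
    (hb : ∀ W : Gr E k, haarUnitary E {U | (U, W) ∈ Gr.exceedPair F c} ≤ b) :
    μ (Gr.exceed F c) ≤ b := by
  have := hμ.isProbabilityMeasure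
  have hS := (Gr.isOpen_exceedPair (k := k) hF c).measurableSet
  -- By invariance of `μ` all sections over `U` have the same measure; Tonelli then trades them for
  -- sections over `W`.
  have h1 : ∀ U : unitary (E →L[ℂ] E), μ {W | (U, W) ∈ Gr.exceedPair F c} = μ (Gr.exceed F c) := by
    intro U
    rw [← Gr.preimage_unitaryMap_exceed]
    exact (hμ.measurePreserving _).measure_preimage (Gr.isOpen_exceed hF c).nullMeasurableSet
  calc μ (Gr.exceed F c)
      = ∫⁻ U, μ (Prod.mk U ⁻¹' Gr.exceedPair F c) ∂(haarUnitary E) := by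
        have : ∀ U : unitary (E →L[ℂ] E),
          μ (Prod.mk U ⁻¹' Gr.exceedPair F c) = μ (Gr.exceed F c) := h1
        simp [this]
    _ = ((haarUnitary E).prod μ) (Gr.exceedPair F c) := (Measure.prod_apply hS).symm
    _ = ∫⁻ W, haarUnitary E ((fun U => (U, W)) ⁻¹' Gr.exceedPair F c) ∂μ :=
        Measure.prod_apply_symm hS
    _ ≤ ∫⁻ _, b ∂μ := lintegral_mono fun W => hb W
    _ = b := by simp

theorem exists_net_pureStates (W : Submodule ℂ E) {δ : ℝ} (hδ : 0 < δ) :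
    ∃ s : Finset E, (∀ x ∈ s, ‖x‖ = 1) ∧ (∀ y ∈ pureStates W, ∃ x ∈ s, ‖y - x‖ < δ) ∧
      (s.card : ℝ) ≤ (1 + 2 / δ) ^ (2 * finrank ℂ W) := by
  obtain ⟨s, h1, h2, h3⟩ := exists_net_unit_vectors W hδ
  refine ⟨s.map ⟨Subtype.val, Subtype.val_injective⟩, ?_, ?_, ?_⟩
  · intro x hx
    obtain ⟨w, hw, rfl⟩ := Finset.mem_map.1 hx
    exact h1 w hw
  · rintro y ⟨hyW, hy⟩
    obtain ⟨c, hc, hyc⟩ := h2 ⟨y, hyW⟩ hy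
    exact ⟨c, Finset.mem_map.2 ⟨c, hc, rfl⟩, hyc⟩
  · rw [Finset.card_map]
    rwa [finrank_real_of_complex] at h3

/-- If some rotated unit vector of `W` exceeds the threshold, a net point within `δ` has a rotated
value lower by at most `K δ`, so it still exceeds its mean by `t`. Lévy's lemma and a union bound
over the net finish. -/
theorem haarUnitary_exceedPair_le {f : E → ℝ} {K B : NNReal}
    (hK : ∀ x y : E, ‖x‖ = 1 → ‖y‖ = 1 → |f x - f y| ≤ K * ‖x - y‖) (hKpos : 0 < K)
    (hB : ∀ x : E, ‖x‖ = 1 → |f x| ≤ B) {r : ℝ} (hr : ∀ x : E, ‖x‖ = 1 → sphereMean x f ≤ r)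
    {t δ : ℝ} (ht : 0 ≤ t) (hδ : 0 < δ) (W : Gr E k) :
    (haarUnitary E) {U | (U, W) ∈ Gr.exceedPair (homogeneousExtension f) (r + t + K * δ)}
      ≤ ENNReal.ofReal ((1 + 2 / δ) ^ (2 * k) *
        Real.exp (-(8 * finrank ℂ E * t ^ 2 / (Real.pi ^ 3 * (B + 2 * K) ^ 2)))) := by
  borelize E
  obtain ⟨s, hs1, hs2, hs3⟩ := exists_net_pureStates W.1 hδ
  rw [W.2] at hs3
  set e := Real.exp (-(8 * finrank ℂ E * t ^ 2 / (Real.pi ^ 3 * (B + 2 * K) ^ 2))) with he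
  have hsub : {U : unitary (E →L[ℂ] E) |
      (U, W) ∈ Gr.exceedPair (homogeneousExtension f) (r + t + K * δ)}
      ⊆ ⋃ x ∈ s, {U | sphereMean x f + t < f ((U : E →L[ℂ] E) x)} := by
    rintro U ⟨v, hv, h⟩
    -- At the zero vector both sides of the strict inequality vanish.
    have hv0 : v ≠ 0 := by
      rintro rfl
      simp [homogeneousExtension] at h
    have hvpos : 0 < ‖v‖ := norm_pos_iff.2 hv0
    obtain ⟨x, hx, hvx⟩ := hs2 ((‖v‖⁻¹ : ℂ) • v)
      ⟨W.1.smul_mem _ hv, norm_inv_norm_smul hv0⟩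
    rw [homogeneousExtension, Unitary.norm_map, mul_comm, mul_lt_mul_iff_right₀ hvpos,
      ← map_smul] at h
    simp only [Set.mem_iUnion]
    refine ⟨x, hx, ?_⟩
    have h1 := hK ((U : E →L[ℂ] E) ((‖v‖⁻¹ : ℂ) • v)) ((U : E →L[ℂ] E) x)
      (by rw [Unitary.norm_map, norm_inv_norm_smul hv0]) (by rw [Unitary.norm_map, hs1 x hx])
    rw [← map_sub, Unitary.norm_map] at h1
    have h2 : (K : ℝ) * ‖(‖v‖⁻¹ : ℂ) • v - x‖ ≤ K * δ := by gcongr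
    have h3 := (le_abs_self _).trans h1
    have h4 := hr x (hs1 x hx)
    change sphereMean x f + t < f ((U : E →L[ℂ] E) x)
    linarith
  have hx : ∀ x ∈ s, (haarUnitary E) {U | sphereMean x f + t < f ((U : E →L[ℂ] E) x)}
      ≤ ENNReal.ofReal e := by
    intro x hx
    have h1 := haarUnitary_real_lt_apply_le hK hB (by positivity) (hs1 x hx) ht
    rw [measureReal_def] at h1
    exact (ENNReal.le_ofReal_iff_toReal_le (measure_ne_top _ _) (Real.exp_pos _).le).2 h1
  calc _ ≤ ∑ x ∈ s, (haarUnitary E) {U | sphereMean x f + t < f ((U : E →L[ℂ] E) x)} :=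
        (measure_mono hsub).trans (measure_biUnion_finset_le _ _)
    _ ≤ ∑ _x ∈ s, ENNReal.ofReal e := Finset.sum_le_sum hx
    _ = ENNReal.ofReal (s.card * e) := by
        rw [Finset.sum_const, nsmul_eq_mul, ENNReal.ofReal_mul (by positivity),
          ENNReal.ofReal_natCast]
    _ ≤ _ := ENNReal.ofReal_le_ofReal (by gcongr)

end Grassmannian

theorem exists_pureState_of_lt_maxInaccuracy₁ {d₁ d₂ : ℕ} {C : Set (Bipartite d₁ d₂)} {c : ℝ}
    (hc : 0 ≤ c) (h : c < maxInaccuracy₁ C) : ∃ ψ ∈ C, c < inaccuracy₁ ψ := by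
  -- The supremum of the empty set is `0` by convention, which `0 ≤ c` excludes.
  rcases C.eq_empty_or_nonempty with rfl | hC
  · simp [maxInaccuracy₁] at h
    linarith
  · obtain ⟨_, ⟨ψ, hψ, rfl⟩, hlt⟩ := exists_lt_of_lt_csSup (hC.image _) h
    exact ⟨ψ, hψ, hlt⟩

/-- Here `B + 2K = 6`, so the exponent is `nα²/(18π³) = nα²/(72π³ · ¼)`, and `ln 2 ≥ ¼` suffices.
The bound `α ≤ 2` turns `1 + 8/α` into at most `10/α`. -/
theorem net_card_mul_exp_le {n α : ℝ} (k : ℕ) (hn : 0 ≤ n) (hα : 0 < α) (hα2 : α ≤ 2) :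
    (1 + 2 / (α / 4)) ^ (2 * k) * Real.exp (-(8 * n * (α / 2) ^ 2 / (Real.pi ^ 3 * (2 + 2 * 2) ^ 2)))
      ≤ 2 * (10 / α) ^ (2 * k) * Real.exp (-(n * α ^ 2 / (72 * Real.pi ^ 3 * Real.log 2))) := by
  have hlog : (1:ℝ) / 4 ≤ Real.log 2 := by linarith [Real.log_two_gt_d9]
  have hpi := Real.pi_pos
  have hlog0 : 0 < Real.log 2 := by linarith
  have h1 : 1 + 2 / (α / 4) ≤ 10 / α := by
    rw [le_div_iff₀ hα]
    field_simp
    linarith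
  have h2 : n * α ^ 2 / (72 * Real.pi ^ 3 * Real.log 2)
      ≤ 8 * n * (α / 2) ^ 2 / (Real.pi ^ 3 * (2 + 2 * 2) ^ 2) := by
    have e : 8 * n * (α / 2) ^ 2 / (Real.pi ^ 3 * (2 + 2 * 2) ^ 2)
        = n * α ^ 2 / (72 * Real.pi ^ 3 * (1 / 4)) := by
      field_simp; ring
    rw [e]
    gcongr
  calc _ ≤ (10 / α) ^ (2 * k) * Real.exp (-(n * α ^ 2 / (72 * Real.pi ^ 3 * Real.log 2))) := by
        gcongr
    _ ≤ _ := by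
        rw [mul_assoc 2]
        have : 0 ≤ (10 / α) ^ (2 * k) * Real.exp (-(n * α ^ 2 / (72 * Real.pi ^ 3 * Real.log 2))) := by
          positivity
        linarith

end RandomSubspace

end

/-! ### Assembly -/

theorem theorem4 (d₁ d₂ dC : ℕ) (hdC : 1 ≤ dC)
    (μ : MeasureTheory.Measure (RandomSubspace.Gr (RandomSubspace.Bipartite d₁ d₂) dC))
    (hμ : RandomSubspace.Gr.IsUniform μ) (α : ℝ) (hα : 0 < α) :
    μ.real {HC | RandomSubspace.maxInaccuracy₁ (RandomSubspace.pureStates HC.1) >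
        √(((d₁ : ℝ) ^ 2 - 1) / ((d₁ : ℝ) * d₂ + 1)) + α} ≤
      2 * (10 / α) ^ (2 * dC) *
        Real.exp (-((d₁ : ℝ) * d₂ * α ^ 2 / (72 * Real.pi ^ 3 * Real.log 2))) := by
  have hprob := hμ.isProbabilityMeasure
  -- A probability measure needs a nonempty Grassmannian, so `1 ≤ dC ≤ d₁d₂` and both factors are
  -- positive.
  obtain ⟨HC⟩ : Nonempty (RandomSubspace.Gr (RandomSubspace.Bipartite d₁ d₂) dC) :=
    nonempty_of_isProbabilityMeasure μ
  have hpos : 0 < d₁ * d₂ := by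
    have h1 := HC.1.finrank_le
    rw [HC.2] at h1
    simp only [finrank_euclideanSpace, Fintype.card_prod, Fintype.card_fin] at h1
    omega
  have h₁ : 0 < d₁ := Nat.pos_of_mul_pos_right hpos
  have h₂ : 0 < d₂ := Nat.pos_of_mul_pos_left hpos
  set r := √(((d₁ : ℝ) ^ 2 - 1) / ((d₁ : ℝ) * d₂ + 1)) with hr
  have hr0 : 0 ≤ r := Real.sqrt_nonneg _
  have hlip : ∀ ψ φ : RandomSubspace.Bipartite d₁ d₂, ‖ψ‖ = 1 → ‖φ‖ = 1 →
      |RandomSubspace.inaccuracy₁ ψ - RandomSubspace.inaccuracy₁ φ| ≤ (2 : NNReal) * ‖ψ - φ‖ :=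
    RandomSubspace.abs_inaccuracy₁_sub_le
  have hbd : ∀ ψ : RandomSubspace.Bipartite d₁ d₂, ‖ψ‖ = 1 →
      |RandomSubspace.inaccuracy₁ ψ| ≤ (2 : NNReal) := fun ψ hψ => by
    rw [abs_of_nonneg (RandomSubspace.inaccuracy₁_nonneg ψ)]
    exact RandomSubspace.inaccuracy₁_le_two ψ hψ
  have hFc := (lipschitzWith_homogeneousExtension hlip hbd).continuous
  rcases le_or_gt α 2 with hα2 | hα2
  · refine le_trans ?_ (RandomSubspace.net_card_mul_exp_le (n := (d₁ : ℝ) * d₂) dC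
      (by positivity) hα hα2)
    have hsub : {HC : RandomSubspace.Gr (RandomSubspace.Bipartite d₁ d₂) dC |
        RandomSubspace.maxInaccuracy₁ (RandomSubspace.pureStates HC.1) > r + α}
        ⊆ RandomSubspace.Gr.exceed (homogeneousExtension RandomSubspace.inaccuracy₁) (r + α) := by
      intro W hW
      obtain ⟨ψ, ⟨hψW, hψ⟩, h⟩ :=
        RandomSubspace.exists_pureState_of_lt_maxInaccuracy₁ (by positivity) hW
      refine ⟨ψ, hψW, ?_⟩
      have h1 := homogeneousExtension_smul (f := RandomSubspace.inaccuracy₁) hψ zero_le_one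
      rw [Complex.ofReal_one, one_smul, one_mul] at h1
      rw [h1, hψ, mul_one]
      exact h
    refine ENNReal.toReal_le_of_le_ofReal (by positivity) ((measure_mono hsub).trans ?_)
    refine hμ.measure_exceed_le hFc _ fun W => ?_
    have h1 := RandomSubspace.haarUnitary_exceedPair_le hlip two_pos hbd
      (fun x hx => RandomSubspace.sphereMean_inaccuracy₁_le h₁ h₂ hx)
      (t := α / 2) (δ := α / 4) (by positivity) (by positivity) W
    -- The budget: `α/2` for the deviation and `2 · α/4` for the net.
    have e : r + α / 2 + ((2 : NNReal) : ℝ) * (α / 4) = r + α := by push_cast; ring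
    rw [← hr, e] at h1
    simpa using h1
  -- The inaccuracy never exceeds `2`, so nothing lies above `r + α` when `α > 2`.
  · have hempty : {HC : RandomSubspace.Gr (RandomSubspace.Bipartite d₁ d₂) dC |
        RandomSubspace.maxInaccuracy₁ (RandomSubspace.pureStates HC.1) > r + α} = ∅ := by
      refine Set.eq_empty_of_forall_notMem fun W hW => ?_
      obtain ⟨ψ, ⟨_, hψ⟩, h⟩ :=
        RandomSubspace.exists_pureState_of_lt_maxInaccuracy₁ (by positivity) hW
      linarith [RandomSubspace.inaccuracy₁_le_two ψ hψ]
    rw [hempty]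
    simp only [measureReal_empty]
    positivity
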